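/- A Stirling permutation of order $n$ is a rearrangement $\sigma$ of the multiset $\{1^2,2^2,\dots,n^2\}$ in which every letter between the two occurrences of $i$ is greater than $i$, for each $i$; $\mathcal{Q}_n$ denotes the set of these ($\mathcal{Q}_0$ consists of the empty word). The block $[i,i]_\sigma$ is the segment of $\sigma$ from the first to the second occurrence of $i$, inclusive. It is a level $1$ block if it is contained in no other block; for $\ell\ge 2$ it is a level $\ell$ block if it is contained in a level $\ell-1$ block $[j,j]_\sigma$ (its parent), $j\neq i$, and is a level $1$ block of the word strictly between the two occurrences of $j$. Two blocks are siblings if both are of level $1$ or they have the same parent. Let $\mathrm{bl}^{(\ell)}(\sigma)$ be the number of level $\ell$ blocks of $\sigma$. A pattern $p$ is a permutation $p_1\cdots p_m$ of $\{1,\dots,m\}$, $m\ge 1$, in which some consecutive entries may be connected by underlines; we also allow the symbol $\emptyset$, a pattern that never occurs. An occurrence of $p$ in a permutation $\pi$ is a choice of positions $i_1<\dots<i_m$ such that $\pi_{i_1}\cdots\pi_{i_m}$ is order isomorphic to $p_1\cdots p_m$ and $i_{j+1}=i_j+1$ whenever $p_j$ and $p_{j+1}$ are connected by an underline; $p(\pi)$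 is the number of occurrences. An occurrence of $p$ in $\sigma\in\mathcal{Q}_n$ at level $\ell$ is a sequence of pairwise sibling level $\ell$ blocks $[b_1,b_1]_\sigma,\dots,[b_m,b_m]_\sigma$, appearing from left to right in $\sigma$, such that $b_1\cdots b_m$ is order isomorphic to $p_1\cdots p_m$ and, whenever $p_j$ and $p_{j+1}$ are connected by an underline, the second occurrence of $b_j$ is immediately followed by the first occurrence of $b_{j+1}$; $p^{(\ell)}(\sigma)$ is the number of such occurrences. For a set $A$ of patterns, a pattern $p$ and $n\ge 0$ put $$f_n^{A,p}(z)=\sum_{\pi} z^{p(\pi)},$$ the sum being over all permutations $\pi$ of $\{1,\dots,n\}$ with $a(\pi)=0$ for all $a\in A$. For a sequence $\mathbf{A}=(A_1,A_2,\dots)$ of sets of patterns, a sequence $\mathbf{p}=(p_1,p_2,\dots)$ of patterns, and sequences of variables $\mathbf{x}=(x_1,x_2,\dots)$, $\mathbf{y}=(y_1,y_2,\dots)$, put $$g_n^{\mathbf{A},\mathbf{p}}(\mathbf{x};\mathbf{y})=\sum_{\sigma}\prod_{i\ge 1}x_i^{p_i^{(i)}(\sigma)}\,y_i^{\mathrm{bl}^{(i)}(\sigma)},$$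 the sum being over all $\sigma\in\mathcal{Q}_n$ with $a^{(i)}(\sigma)=0$ for all $i\ge 1$ and all $a\in A_i$. In particular $f_0^{A,p}=g_0^{\mathbf{A},\mathbf{p}}=1$. Write $\mathrm{sh}(s_1,s_2,s_3,\dots)=(s_2,s_3,\dots)$. Then for every $n\ge 0$ $$g_n^{\mathbf{A},\mathbf{p}}(\mathbf{x};\mathbf{y})=\sum_{\lambda\vdash n}\binom{n}{\lambda}\,\frac{y_1^{\ell(\lambda)}\,f_{\ell(\lambda)}^{A_1,p_1}(x_1)}{m_1(\lambda)!\cdots m_n(\lambda)!}\prod_{i=1}^{\ell(\lambda)}g_{\lambda_i-1}^{\mathrm{sh}(\mathbf{A}),\mathrm{sh}(\mathbf{p})}(\mathrm{sh}(\mathbf{x});\mathrm{sh}(\mathbf{y})),$$ where $\lambda=(\lambda_1,\dots,\lambda_{\ell(\lambda)})$ runs over the integer partitions of $n$, $\ell(\lambda)$ is the number of parts of $\lambda$, $m_i(\lambda)$ is the number of parts equal to $i$, and $\binom{n}{\lambda}=\frac{n!}{\lambda_1!\cdots\lambda_{\ell(\lambda)}!}$. The identity holds for all values of the variables in a commutative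 $\mathbb{Q}$-algebra, in particular as an identity of polynomials. -/

import Mathlib

namespace BlockPattern

/-! Words are lists of natural numbers; positions in a word are counted from `0`. -/

/-- Position of the first occurrence of `i` in `w` (meaningful when `i ∈ w`). -/
def firstPos (w : List ℕ) (i : ℕ) : ℕ := w.idxOf i

/-- Position of the last occurrence of `i` in `w` (meaningful when `i ∈ w`). -/
def lastPos (w : List ℕ) (i : ℕ) : ℕ := w.length - 1 - w.reverse.idxOf i

/-- The word `(i,i)_w` strictly between the first and the last occurrence of `i` in `w`. -/
def inner (w : List ℕ) (i : ℕ) : List ℕ := (w.take (lastPos w i)).drop (firstPos w i + 1)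

/-- Between any two occurrences of `i`, every letter (other than `i`) is greater than `i`;
stated for words in which no letter occurs more than twice. -/
def IsStirlingWord (w : List ℕ) : Prop :=
  ∀ a b c i j : ℕ, a < b → b < c →
    w[a]? = some i → w[c]? = some i → w[b]? = some j → i < j

open Classical in
/-- The finite set `Q_n` of Stirling permutations of order `n`: rearrangements of the multiset
`{1,1,2,2,…,n,n}` in which all letters between the two occurrences of `i` exceed `i`. -/
noncomputable def stirlingPerms (n : ℕ) : Finset (List ℕ) :=
  (2 • (Finset.Icc 1 n).val).lists.toFinset.filter IsStirlingWord

/-- `[i,i]_w ⊂ [j,j]_w`: the letters differ, and the segment of `w` from the first to the last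
occurrence of `i` lies inside the segment from the first to the last occurrence of `j`. -/
def BlockSub (w : List ℕ) (i j : ℕ) : Prop :=
  i ≠ j ∧ firstPos w j ≤ firstPos w i ∧ lastPos w i ≤ lastPos w j

/-- `[i,i]_w` is a level 1 block of `w`. -/
def IsLevelOne (w : List ℕ) (i : ℕ) : Prop :=
  i ∈ w ∧ ∀ j ∈ w, ¬ BlockSub w i j

/-- `IsLevel w l i`: `[i,i]_w` is a level `l` block of `w` (there are no blocks of level `0`). -/
def IsLevel (w : List ℕ) : ℕ → ℕ → Prop
  | 0, _ => False
  | 1, i => IsLevelOne w i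
  | l + 2, i => ∃ j, IsLevel w (l + 1) j ∧ BlockSub w i j ∧ IsLevelOne (inner w j) i

/-- `[j,j]_w` is the parent of the block `[i,i]_w`. -/
def IsParent (w : List ℕ) (j i : ℕ) : Prop :=
  BlockSub w i j ∧ ∃ l, IsLevel w (l + 1) i ∧ IsLevel w l j

/-- The blocks `[i,i]_w` and `[j,j]_w` are siblings. -/
def AreSiblings (w : List ℕ) (i j : ℕ) : Prop :=
  (IsLevel w 1 i ∧ IsLevel w 1 j) ∨ ∃ k, IsParent w k i ∧ IsParent w k j

/-- `bl^{(l)}(w)`: the number of level `l` blocks of `w`. -/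
noncomputable def blockCount (w : List ℕ) (l : ℕ) : ℕ := {i | IsLevel w l i}.ncard

/-- A permutation pattern: a permutation of length `len`, some of whose consecutive entries are
underlined. With entries numbered from `0`, `j ∈ underline` says that entries `j` and `j + 1`
are connected by an underline. The pattern of length `0` is the symbol `∅`, "no pattern". -/
structure PermPattern where
  len : ℕ
  perm : Equiv.Perm (Fin len)
  underline : Set ℕ
  underline_lt : ∀ j ∈ underline, j + 1 < len

/-- The word `u`, of the length of `p`, is order isomorphic to the permutation of `p`. -/
def PermPattern.Matches (p : PermPattern) {α : Type*} [LinearOrder α] (u : Fin p.len → α) : Prop :=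
  ∀ s t : Fin p.len, u s < u t ↔ p.perm s < p.perm t

/-- The occurrences (as tuples of positions) of the pattern `p` in the word `w`.
The pattern `∅` never occurs. -/
def PermPattern.occurrences (p : PermPattern) {n : ℕ} {α : Type*} [LinearOrder α]
    (w : Fin n → α) : Set (Fin p.len → Fin n) :=
  {i | 0 < p.len ∧ StrictMono i ∧ p.Matches (fun s => w (i s)) ∧
    ∀ s t : Fin p.len, (s : ℕ) ∈ p.underline → (t : ℕ) = s + 1 → (i t : ℕ) = i s + 1}

/-- `p(π)`: the number of occurrences of `p` in the permutation `π`. -/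
noncomputable def PermPattern.count (p : PermPattern) {n : ℕ} (π : Equiv.Perm (Fin n)) : ℕ :=
  (p.occurrences (fun k => π k)).ncard

/-- The occurrences (as tuples of letters `b_1, …, b_m`) of `p` as a block pattern at level `l`
in `σ`. The pattern `∅` never occurs. -/
def PermPattern.blockOccurrences (p : PermPattern) (σ : List ℕ) (l : ℕ) : Set (Fin p.len → ℕ) :=
  {b | 0 < p.len ∧ (∀ s, IsLevel σ l (b s)) ∧ (∀ s t, AreSiblings σ (b s) (b t)) ∧
    StrictMono (fun s => firstPos σ (b s)) ∧ p.Matches b ∧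
    ∀ s t : Fin p.len, (s : ℕ) ∈ p.underline → (t : ℕ) = s + 1 →
      firstPos σ (b t) = lastPos σ (b s) + 1}

/-- `p^{(l)}(σ)`: the number of occurrences of `p` as a block pattern at level `l` in `σ`. -/
noncomputable def PermPattern.levelCount (p : PermPattern) (σ : List ℕ) (l : ℕ) : ℕ :=
  (p.blockOccurrences σ l).ncard

open Classical in
/-- `f_n^{A,p}(z)`: the sum of `z ^ p(π)` over the permutations `π` of length `n` avoiding `A`. -/
noncomputable def fCoeff {R : Type*} [CommRing R] (A : Set PermPattern) (p : PermPattern)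
    (n : ℕ) (z : R) : R :=
  ∑ π ∈ (Finset.univ : Finset (Equiv.Perm (Fin n))).filter (fun π => ∀ a ∈ A, a.count π = 0),
    z ^ p.count π

/-! A sequence `(s_1, s_2, …)` is a function `s` on `ℕ` with `s i` standing for `s_{i+1}`. -/

/-- `sh(s) = (s_2, s_3, …)`. -/
def shift {α : Type*} (s : ℕ → α) : ℕ → α := fun i => s (i + 1)

open Classical in
/-- `Q_n(A)`: the Stirling permutations of order `n` avoiding, for every `i ≥ 1`, all patterns
of `A_i` at level `i`. -/
noncomputable def stirlingAvoiding (A : ℕ → Set PermPattern) (n : ℕ) : Finset (List ℕ) :=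
  (stirlingPerms n).filter (fun σ => ∀ i, ∀ a ∈ A i, a.levelCount σ (i + 1) = 0)

/-- `g_n^{A,p}(x; y)`. For each `σ` only finitely many factors of the product differ from `1`,
as `σ` has only finitely many blocks. -/
noncomputable def gCoeff {R : Type*} [CommRing R] (A : ℕ → Set PermPattern) (p : ℕ → PermPattern)
    (n : ℕ) (x y : ℕ → R) : R :=
  ∑ σ ∈ stirlingAvoiding A n,
    ∏ᶠ i : ℕ, x i ^ (p i).levelCount σ (i + 1) * y i ^ blockCount σ (i + 1)

end BlockPattern

/-!
A Stirling permutation is the concatenation of its level 1 blocks. It is determined by the set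
partition of its letters into the letter sets of these blocks, by the order of the blocks, and
by their interiors, which are arbitrary Stirling permutations of the part without its minimum,
the outer letter of the block. The level 1 data are the pattern occurrences in the permutation
formed by the minima of the parts, and the data at level `l + 2` are the sums over the blocks of
the data of the interiors at level `l + 1`. Hence, for a fixed set partition, summation over the
orders gives `f` and summation over the interiors gives a product of shifted `g`s; it remains to
count the set partitions with given part sizes.
-/

namespace BlockPattern

/-! ### Segments of words -/

section Segment
variable {pre w post : List ℕ} {i j : ℕ}

lemma firstPos_lt_length (h : i ∈ w) : firstPos w i < w.length := List.idxOf_lt_length_of_mem h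

lemma lastPos_lt_length (h : i ∈ w) : lastPos w i < w.length := by
  have := List.length_pos_of_mem h
  unfold lastPos
  omega

lemma firstPos_inj (hi : i ∈ w) : firstPos w i = firstPos w j ↔ i = j := List.idxOf_inj hi

lemma firstPos_segment (h : i ∈ w) (hpre : i ∉ pre) :
    firstPos (pre ++ w ++ post) i = pre.length + firstPos w i := by
  unfold firstPos
  rw [List.append_assoc, List.idxOf_append_of_notMem hpre, List.idxOf_append_of_mem h]

lemma lastPos_segment (h : i ∈ w) (hpost : i ∉ post) :
    lastPos (pre ++ w ++ post) i = pre.length + lastPos w i := by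
  unfold lastPos
  have hrev : i ∈ w.reverse := List.mem_reverse.2 h
  have hlt := List.idxOf_lt_length_of_mem hrev
  rw [List.reverse_append, List.reverse_append,
    List.idxOf_append_of_notMem (mt List.mem_reverse.1 hpost), List.idxOf_append_of_mem hrev]
  simp only [List.length_append, List.length_reverse] at *
  omega

lemma inner_segment (h : i ∈ w) (hpre : i ∉ pre) (hpost : i ∉ post) :
    inner (pre ++ w ++ post) i = inner w i := by
  have := lastPos_lt_length h
  unfold inner
  rw [firstPos_segment h hpre, lastPos_segment h hpost, List.append_assoc, List.take_append,
    List.take_of_length_le (by omega), Nat.add_sub_cancel_left,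
    List.take_append_of_le_length (by omega), add_assoc, List.drop_append,
    List.drop_of_length_le (by omega), Nat.add_sub_cancel_left, List.nil_append]

lemma inner_subset : inner w i ⊆ w :=
  fun _ h => List.mem_of_mem_take (List.mem_of_mem_drop h)

lemma IsLevel.mem {l : ℕ} (h : IsLevel w l i) : i ∈ w := by
  match l with
  | 0 => exact h.elim
  | 1 => exact h.1
  | l + 2 =>
    obtain ⟨j, _, _, h⟩ := h
    exact inner_subset h.1

lemma IsLevel.le_firstPos {l : ℕ} (h : IsLevel w l i) : l ≤ firstPos w i + 1 := by
  induction l generalizing i with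
  | zero => omega
  | succ l ih =>
    cases l with
    | zero => omega
    | succ l =>
      obtain ⟨j, hj, ⟨hne, hle, -⟩, -⟩ := h
      have hpos : firstPos w j ≠ firstPos w i := fun e => hne ((firstPos_inj hj.mem).1 e).symm
      have := ih hj
      omega

lemma IsLevel.le_length {l : ℕ} (h : IsLevel w l i) : l ≤ w.length :=
  h.le_firstPos.trans (firstPos_lt_length h.mem)

lemma IsParent.mem_parent (h : IsParent w j i) : j ∈ w :=
  let ⟨_, _, _, hj⟩ := h
  hj.mem

lemma IsParent.mem_child (h : IsParent w j i) : i ∈ w :=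
  let ⟨_, _, hi, _⟩ := h
  hi.mem

lemma AreSiblings.mem_left (h : AreSiblings w i j) : i ∈ w :=
  h.elim (fun h => h.1.mem) fun ⟨_, h, _⟩ => h.mem_child

lemma AreSiblings.mem_right (h : AreSiblings w i j) : j ∈ w :=
  h.elim (fun h => h.2.mem) fun ⟨_, _, h⟩ => h.mem_child

end Segment

/-! ### Words assembled from blocks -/

/-- The block `b w b` with outer letter `b` and interior `w`, encoded as the pair `(b, w)`. -/
def blockWord (B : ℕ × List ℕ) : List ℕ := B.1 :: (B.2 ++ [B.1])

/-- The concatenation of a list of blocks, the general form of a Stirling permutation. -/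
def assemble (L : List (ℕ × List ℕ)) : List ℕ := L.flatMap blockWord

/-- Lists of blocks that remain the level 1 blocks of the assembled word: no block contains its
outer letter in its interior, and different blocks share no letters. -/
structure Separated (L : List (ℕ × List ℕ)) : Prop where
  head_notMem : ∀ B ∈ L, B.1 ∉ B.2
  pairwise_disjoint : L.Pairwise fun B C => (blockWord B).Disjoint (blockWord C)

lemma mem_blockWord {B : ℕ × List ℕ} {i : ℕ} : i ∈ blockWord B ↔ i = B.1 ∨ i ∈ B.2 := by
  simp only [blockWord, List.mem_cons, List.mem_append, List.not_mem_nil, or_false]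
  tauto

lemma head_mem_blockWord (B : ℕ × List ℕ) : B.1 ∈ blockWord B := mem_blockWord.2 (Or.inl rfl)

lemma mem_blockWord_of_mem {B : ℕ × List ℕ} {i : ℕ} (h : i ∈ B.2) : i ∈ blockWord B :=
  mem_blockWord.2 (Or.inr h)

lemma mem_assemble {L : List (ℕ × List ℕ)} {i : ℕ} :
    i ∈ assemble L ↔ ∃ B ∈ L, i ∈ blockWord B := List.mem_flatMap

lemma length_blockWord (B : ℕ × List ℕ) : (blockWord B).length = B.2.length + 2 := by
  simp [blockWord]

lemma firstPos_blockWord (B : ℕ × List ℕ) : firstPos (blockWord B) B.1 = 0 := by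
  simp [firstPos, blockWord]

lemma lastPos_blockWord (B : ℕ × List ℕ) : lastPos (blockWord B) B.1 = B.2.length + 1 := by
  simp [lastPos, blockWord]

lemma inner_blockWord (B : ℕ × List ℕ) : inner (blockWord B) B.1 = B.2 := by
  rw [inner, firstPos_blockWord, lastPos_blockWord]
  simp [blockWord]

lemma assemble_eq_append (L : List (ℕ × List ℕ)) {m : ℕ} (hm : m < L.length) :
    assemble L = assemble (L.take m) ++ blockWord L[m] ++ assemble (L.drop (m + 1)) := by
  conv_lhs => rw [← List.take_append_drop m L, List.drop_eq_getElem_cons hm]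
  simp only [assemble, List.flatMap_append, List.flatMap_cons, List.append_assoc]

/-- The position in `assemble L` at which the block `L[m]` starts. -/
def startPos (L : List (ℕ × List ℕ)) (m : ℕ) : ℕ := (assemble (L.take m)).length

section StartPos
variable {L : List (ℕ × List ℕ)} {a b : ℕ}

lemma startPos_succ (ha : a < L.length) :
    startPos L (a + 1) = startPos L a + (blockWord L[a]).length := by
  rw [startPos, startPos, List.take_add_one, List.getElem?_eq_getElem ha, assemble,
    List.flatMap_append, List.length_append]
  simp [assemble]

variable (L) in
lemma startPos_mono : Monotone (startPos L) := by
  refine monotone_nat_of_le_succ fun m => ?_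
  by_cases hm : m < L.length
  · exact (startPos_succ hm).ge.trans' (Nat.le_add_right _ _)
  · rw [startPos, startPos, List.take_of_length_le (by omega), List.take_of_length_le (by omega)]

lemma startPos_lt_startPos (hb : b < L.length) : startPos L a < startPos L b ↔ a < b := by
  refine ⟨fun h => lt_of_not_ge fun hba => h.not_ge (startPos_mono L hba), fun hab => ?_⟩
  have hlen := length_blockWord L[a]
  have hsucc := startPos_succ (hab.trans hb)
  have := startPos_mono L (Nat.add_one_le_of_lt hab)
  omega

lemma startPos_eq_startPos_succ (ha : a < L.length) (hb : b < L.length) :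
    startPos L b = startPos L (a + 1) ↔ b = a + 1 := by
  refine ⟨fun h => ?_, fun h => by rw [h]⟩
  have hab : a < b := by
    rw [← startPos_lt_startPos hb, h, startPos_succ ha, length_blockWord]
    omega
  exact le_antisymm (not_lt.1 fun hlt => ((startPos_lt_startPos hb).2 hlt).ne' h) hab

end StartPos

namespace Separated
variable {L : List (ℕ × List ℕ)} (h : Separated L) {B C : ℕ × List ℕ} {i j m : ℕ}
include h

lemma eq_of_mem (hB : B ∈ L) (hC : C ∈ L) (hiB : i ∈ blockWord B) (hiC : i ∈ blockWord C) :
    B = C := by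
  have : Std.Symm fun B C : ℕ × List ℕ => (blockWord B).Disjoint (blockWord C) :=
    ⟨fun _ _ hd => hd.symm⟩
  by_contra hne
  exact h.pairwise_disjoint.forall hB hC hne hiB hiC

lemma nodup : L.Nodup := by
  refine h.pairwise_disjoint.imp fun {B C} hd e => ?_
  exact hd (head_mem_blockWord B) (e ▸ head_mem_blockWord B)

lemma notMem_take (hm : m < L.length) (hi : i ∈ blockWord L[m]) : i ∉ assemble (L.take m) := by
  intro hc
  obtain ⟨B, hB, hiB⟩ := mem_assemble.1 hc
  obtain rfl := h.eq_of_mem (List.mem_of_mem_take hB) (List.getElem_mem hm) hiB hi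
  obtain ⟨a, ha, e⟩ := List.mem_take_iff_getElem.1 hB
  have := h.nodup.getElem_inj_iff.1 e
  omega

lemma notMem_drop (hm : m < L.length) (hi : i ∈ blockWord L[m]) :
    i ∉ assemble (L.drop (m + 1)) := by
  intro hc
  obtain ⟨B, hB, hiB⟩ := mem_assemble.1 hc
  obtain rfl := h.eq_of_mem (List.mem_of_mem_drop hB) (List.getElem_mem hm) hiB hi
  obtain ⟨a, ha, e⟩ := List.mem_drop_iff_getElem.1 hB
  have := h.nodup.getElem_inj_iff.1 e
  omega

lemma firstPos_eq (hm : m < L.length) (hi : i ∈ blockWord L[m]) :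
    firstPos (assemble L) i = startPos L m + firstPos (blockWord L[m]) i := by
  rw [assemble_eq_append L hm, firstPos_segment hi (h.notMem_take hm hi), startPos]

lemma lastPos_eq (hm : m < L.length) (hi : i ∈ blockWord L[m]) :
    lastPos (assemble L) i = startPos L m + lastPos (blockWord L[m]) i := by
  rw [assemble_eq_append L hm, lastPos_segment hi (h.notMem_drop hm hi), startPos]

lemma firstPos_head (hm : m < L.length) : firstPos (assemble L) L[m].1 = startPos L m := by
  rw [h.firstPos_eq hm (head_mem_blockWord _), firstPos_blockWord, add_zero]

lemma lastPos_head (hm : m < L.length) :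
    lastPos (assemble L) L[m].1 + 1 = startPos L (m + 1) := by
  rw [h.lastPos_eq hm (head_mem_blockWord _), lastPos_blockWord, startPos_succ hm,
    length_blockWord, add_assoc]

lemma eq_of_blockSub (hB : B ∈ L) (hC : C ∈ L) (hi : i ∈ blockWord B) (hj : j ∈ blockWord C)
    (hs : BlockSub (assemble L) i j) : B = C := by
  obtain ⟨a, ha, rfl⟩ := List.getElem_of_mem hB
  obtain ⟨b, hb, rfl⟩ := List.getElem_of_mem hC
  obtain ⟨-, hfirst, hlast⟩ := hs
  rw [h.firstPos_eq ha hi, h.firstPos_eq hb hj] at hfirst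
  rw [h.lastPos_eq ha hi, h.lastPos_eq hb hj] at hlast
  have hi_lt := firstPos_lt_length hi
  have hj_lt := lastPos_lt_length hj
  have ha_succ := startPos_succ ha
  have hb_succ := startPos_succ hb
  rcases Nat.lt_trichotomy a b with hlt | rfl | hlt
  · have := startPos_mono L (Nat.add_one_le_of_lt hlt)
    omega
  · rfl
  · have := startPos_mono L (Nat.add_one_le_of_lt hlt)
    omega

lemma exists_eq_append_interior (hB : B ∈ L) : ∃ pre post : List ℕ,
    assemble L = pre ++ B.2 ++ post ∧ ∀ i ∈ B.2, i ∉ pre ∧ i ∉ post := by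
  obtain ⟨m, hm, rfl⟩ := List.getElem_of_mem hB
  refine ⟨assemble (L.take m) ++ [L[m].1], [L[m].1] ++ assemble (L.drop (m + 1)), ?_, ?_⟩
  · rw [assemble_eq_append L hm]
    simp [blockWord]
  · intro i hi
    have hne : i ≠ L[m].1 := fun e => h.head_notMem _ hB (e ▸ hi)
    simp [hne, h.notMem_take hm (mem_blockWord_of_mem hi),
      h.notMem_drop hm (mem_blockWord_of_mem hi)]

lemma exists_offset_interior (hB : B ∈ L) : ∃ c, ∀ i ∈ B.2,
    firstPos (assemble L) i = c + firstPos B.2 i ∧ lastPos (assemble L) i = c + lastPos B.2 i := by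
  obtain ⟨pre, post, e, hn⟩ := h.exists_eq_append_interior hB
  refine ⟨pre.length, fun i hi => ?_⟩
  rw [e]
  exact ⟨firstPos_segment hi (hn i hi).1, lastPos_segment hi (hn i hi).2⟩

lemma length_interior_le (hB : B ∈ L) : B.2.length ≤ (assemble L).length := by
  obtain ⟨pre, post, e, -⟩ := h.exists_eq_append_interior hB
  rw [e, List.append_assoc, List.length_append, List.length_append]
  omega

lemma blockSub_head (hB : B ∈ L) (hi : i ∈ B.2) : BlockSub (assemble L) i B.1 := by
  have hne : i ≠ B.1 := fun e => h.head_notMem _ hB (e ▸ hi)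
  have hiB := mem_blockWord_of_mem hi
  obtain ⟨m, hm, rfl⟩ := List.getElem_of_mem hB
  refine ⟨hne, ?_, Nat.lt_succ_iff.1 ?_⟩
  · rw [h.firstPos_head hm, h.firstPos_eq hm hiB]
    exact Nat.le_add_right _ _
  · rw [Nat.succ_eq_add_one, h.lastPos_head hm, h.lastPos_eq hm hiB, startPos_succ hm]
    exact Nat.add_lt_add_left (lastPos_lt_length hiB) _

lemma not_blockSub_head (hB : B ∈ L) (hj : j ∈ assemble L) :
    ¬ BlockSub (assemble L) B.1 j := by
  intro hs
  obtain ⟨C, hC, hjC⟩ := mem_assemble.1 hj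
  obtain rfl := h.eq_of_blockSub hB hC (head_mem_blockWord B) hjC hs
  have hjB : j ∈ B.2 := (mem_blockWord.1 hjC).resolve_left hs.1.symm
  have hle := (h.blockSub_head hB hjB).2.1
  exact hs.1 ((firstPos_inj hj).1 (le_antisymm hs.2.1 hle)).symm

lemma blockSub_interior (hB : B ∈ L) (hi : i ∈ B.2) (hj : j ∈ B.2) :
    BlockSub (assemble L) i j ↔ BlockSub B.2 i j := by
  obtain ⟨c, hc⟩ := h.exists_offset_interior hB
  simp only [BlockSub, hc i hi, hc j hj, Nat.add_le_add_iff_left]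

lemma inner_interior (hB : B ∈ L) (hi : i ∈ B.2) : inner (assemble L) i = inner B.2 i := by
  obtain ⟨pre, post, e, hn⟩ := h.exists_eq_append_interior hB
  rw [e, inner_segment hi (hn i hi).1 (hn i hi).2]

lemma inner_head (hB : B ∈ L) : inner (assemble L) B.1 = B.2 := by
  obtain ⟨m, hm, rfl⟩ := List.getElem_of_mem hB
  have hi := head_mem_blockWord L[m]
  rw [assemble_eq_append L hm, inner_segment hi (h.notMem_take hm hi) (h.notMem_drop hm hi),
    inner_blockWord]

lemma isLevel_one : IsLevel (assemble L) 1 i ↔ ∃ B ∈ L, i = B.1 := by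
  constructor
  · rintro ⟨hi, hmax⟩
    obtain ⟨B, hB, hiB⟩ := mem_assemble.1 hi
    refine ⟨B, hB, (mem_blockWord.1 hiB).resolve_right fun hi2 => ?_⟩
    exact hmax _ (mem_assemble.2 ⟨B, hB, head_mem_blockWord B⟩) (h.blockSub_head hB hi2)
  · rintro ⟨B, hB, rfl⟩
    exact ⟨mem_assemble.2 ⟨B, hB, head_mem_blockWord B⟩, fun j hj => h.not_blockSub_head hB hj⟩

lemma isLevel_add_two {l : ℕ} :
    IsLevel (assemble L) (l + 2) i ↔ ∃ B ∈ L, IsLevel B.2 (l + 1) i := by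
  induction l generalizing i with
  | zero =>
    constructor
    · rintro ⟨j, hj, -, hi⟩
      obtain ⟨B, hB, rfl⟩ := h.isLevel_one.1 hj
      rw [h.inner_head hB] at hi
      exact ⟨B, hB, hi⟩
    · rintro ⟨B, hB, hi⟩
      refine ⟨B.1, h.isLevel_one.2 ⟨B, hB, rfl⟩, h.blockSub_head hB hi.1, ?_⟩
      rwa [h.inner_head hB]
  | succ l ih =>
    constructor
    · rintro ⟨j, hj, hs, hi⟩
      obtain ⟨B, hB, hjB⟩ := ih.1 hj
      rw [h.inner_interior hB hjB.mem] at hi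
      exact ⟨B, hB, j, hjB, (h.blockSub_interior hB (inner_subset hi.1) hjB.mem).1 hs, hi⟩
    · rintro ⟨B, hB, j, hj, hs, hi⟩
      refine ⟨j, ih.2 ⟨B, hB, hj⟩, (h.blockSub_interior hB (inner_subset hi.1) hj.mem).2 hs, ?_⟩
      rwa [h.inner_interior hB hj.mem]

lemma isParent_iff : IsParent (assemble L) j i ↔
    ∃ B ∈ L, (j = B.1 ∧ IsLevel B.2 1 i) ∨ (j ∈ B.2 ∧ IsParent B.2 j i) := by
  constructor
  · rintro ⟨hs, l, hi, hj⟩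
    match l with
    | 0 => exact hj.elim
    | l + 1 =>
      obtain ⟨B, hB, hiB⟩ := h.isLevel_add_two.1 hi
      have hiB' := mem_blockWord_of_mem hiB.mem
      match l with
      | 0 =>
        obtain ⟨C, hC, rfl⟩ := h.isLevel_one.1 hj
        obtain rfl := h.eq_of_blockSub hB hC hiB' (head_mem_blockWord C) hs
        exact ⟨B, hB, Or.inl ⟨rfl, hiB⟩⟩
      | l + 1 =>
        obtain ⟨C, hC, hjC⟩ := h.isLevel_add_two.1 hj
        obtain rfl := h.eq_of_blockSub hB hC hiB' (mem_blockWord_of_mem hjC.mem) hs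
        exact ⟨B, hB, Or.inr ⟨hjC.mem, (h.blockSub_interior hB hiB.mem hjC.mem).1 hs,
          l + 1, hiB, hjC⟩⟩
  · rintro ⟨B, hB, ⟨rfl, hi⟩ | ⟨hj, hs, l, hil, hjl⟩⟩
    · exact ⟨h.blockSub_head hB hi.mem, 1, h.isLevel_add_two.2 ⟨B, hB, hi⟩,
        h.isLevel_one.2 ⟨B, hB, rfl⟩⟩
    · match l with
      | 0 => exact hjl.elim
      | l + 1 =>
        exact ⟨(h.blockSub_interior hB hil.mem hj).2 hs, l + 2,
          h.isLevel_add_two.2 ⟨B, hB, hil⟩, h.isLevel_add_two.2 ⟨B, hB, hjl⟩⟩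

lemma areSiblings_iff : AreSiblings (assemble L) i j ↔
    (IsLevel (assemble L) 1 i ∧ IsLevel (assemble L) 1 j) ∨ ∃ B ∈ L, AreSiblings B.2 i j := by
  refine or_congr_right ⟨?_, ?_⟩
  · rintro ⟨k, hki, hkj⟩
    obtain ⟨B, hB, hkB⟩ := h.isParent_iff.1 hki
    obtain ⟨C, hC, hkC⟩ := h.isParent_iff.1 hkj
    obtain rfl := h.eq_of_mem hB hC (mem_blockWord.2 (hkB.imp And.left And.left))
      (mem_blockWord.2 (hkC.imp And.left And.left))
    refine ⟨B, hB, ?_⟩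
    rcases hkB with ⟨rfl, hi⟩ | ⟨hk, hi⟩ <;> rcases hkC with ⟨e, hj⟩ | ⟨hk', hj⟩
    · exact Or.inl ⟨hi, hj⟩
    · exact (h.head_notMem B hB hk').elim
    · exact (h.head_notMem B hB (e ▸ hk)).elim
    · exact Or.inr ⟨k, hi, hj⟩
  · rintro ⟨B, hB, ⟨hi, hj⟩ | ⟨k, hi, hj⟩⟩
    · exact ⟨B.1, h.isParent_iff.2 ⟨B, hB, Or.inl ⟨rfl, hi⟩⟩,
        h.isParent_iff.2 ⟨B, hB, Or.inl ⟨rfl, hj⟩⟩⟩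
    · have hk : k ∈ B.2 := hi.mem_parent
      exact ⟨k, h.isParent_iff.2 ⟨B, hB, Or.inr ⟨hk, hi⟩⟩,
        h.isParent_iff.2 ⟨B, hB, Or.inr ⟨hk, hj⟩⟩⟩

lemma isLevel_interior {l : ℕ} (hB : B ∈ L) (hi : i ∈ B.2) :
    IsLevel (assemble L) (l + 2) i ↔ IsLevel B.2 (l + 1) i := by
  rw [h.isLevel_add_two]
  refine ⟨?_, fun hl => ⟨B, hB, hl⟩⟩
  rintro ⟨C, hC, hl⟩
  obtain rfl := h.eq_of_mem hB hC (mem_blockWord_of_mem hi) (mem_blockWord_of_mem hl.mem)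
  exact hl

lemma areSiblings_interior (hB : B ∈ L) (hi : i ∈ B.2) :
    AreSiblings (assemble L) i j ↔ AreSiblings B.2 i j := by
  rw [h.areSiblings_iff]
  refine ⟨?_, fun hs => Or.inr ⟨B, hB, hs⟩⟩
  rintro (⟨hone, -⟩ | ⟨C, hC, hs⟩)
  · obtain ⟨C, hC, rfl⟩ := h.isLevel_one.1 hone
    obtain rfl := h.eq_of_mem hB hC (mem_blockWord_of_mem hi) (head_mem_blockWord C)
    exact (h.head_notMem B hB hi).elim
  · obtain rfl := h.eq_of_mem hB hC (mem_blockWord_of_mem hi) (mem_blockWord_of_mem hs.mem_left)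
    exact hs

end Separated

/-! ### Counting blocks and block patterns -/

lemma finite_isLevel (w : List ℕ) (l : ℕ) : {i | IsLevel w l i}.Finite :=
  w.toFinset.finite_toSet.subset fun _ hi => List.mem_toFinset.2 (IsLevel.mem hi)

lemma finite_blockOccurrences (p : PermPattern) (w : List ℕ) (l : ℕ) :
    (p.blockOccurrences w l).Finite :=
  (Set.Finite.pi' fun _ : Fin p.len => finite_isLevel w l).subset fun _ hb => hb.2.1

lemma blockCount_of_length_lt {w : List ℕ} {l : ℕ} (h : w.length < l) : blockCount w l = 0 := by
  rw [blockCount, Set.ncard_eq_zero (finite_isLevel w l), Set.eq_empty_iff_forall_notMem]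
  exact fun i hi => h.not_ge (IsLevel.le_length hi)

lemma levelCount_of_length_lt (p : PermPattern) {w : List ℕ} {l : ℕ} (h : w.length < l) :
    p.levelCount w l = 0 := by
  rw [PermPattern.levelCount, Set.ncard_eq_zero (finite_blockOccurrences p w l),
    Set.eq_empty_iff_forall_notMem]
  exact fun b hb => h.not_ge (hb.2.1 ⟨0, hb.1⟩).le_length

namespace Separated
variable {L : List (ℕ × List ℕ)} (h : Separated L) (p : PermPattern)
include h

lemma head_injective : Function.Injective fun m : Fin L.length => L[m].1 := by
  intro m m' e
  have heq : L[m] = L[m'] := h.eq_of_mem (List.getElem_mem m.2) (List.getElem_mem m'.2)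
    (head_mem_blockWord _) (mem_blockWord.2 (Or.inl e))
  exact Fin.ext (h.nodup.getElem_inj_iff.1 heq)

lemma disjoint_interior {m m' : Fin L.length} (hne : m ≠ m') : L[m].2.Disjoint L[m'].2 := by
  intro i hi hi'
  have heq : L[m] = L[m'] := h.eq_of_mem (List.getElem_mem m.2) (List.getElem_mem m'.2)
    (mem_blockWord_of_mem hi) (mem_blockWord_of_mem hi')
  exact hne (Fin.ext (h.nodup.getElem_inj_iff.1 heq))

lemma blockCount_one : blockCount (assemble L) 1 = L.length := by
  have hrange : {i | IsLevel (assemble L) 1 i} = Set.range fun m : Fin L.length => L[m].1 := by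
    ext i
    simp only [Set.mem_ofPred_eq, h.isLevel_one, Set.mem_range, List.mem_iff_get]
    aesop
  rw [blockCount, hrange, ← Set.image_univ, Set.ncard_image_of_injective _ h.head_injective,
    Set.ncard_univ, Nat.card_fin]

lemma blockCount_add_two (l : ℕ) :
    blockCount (assemble L) (l + 2) = ∑ m : Fin L.length, blockCount L[m].2 (l + 1) := by
  have hunion : {i | IsLevel (assemble L) (l + 2) i} =
      ⋃ m : Fin L.length, {i | IsLevel L[m].2 (l + 1) i} := by
    ext i
    simp only [Set.mem_ofPred_eq, h.isLevel_add_two, Set.mem_iUnion, List.mem_iff_get]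
    aesop
  rw [blockCount, hunion, Set.ncard_iUnion_of_finite fun m => finite_isLevel _ _,
    finsum_eq_sum_of_fintype]
  · rfl
  · exact fun m m' hne => Set.disjoint_left.2 fun i hi hi' =>
      h.disjoint_interior hne (IsLevel.mem hi) (IsLevel.mem hi')

lemma mem_blockOccurrences_interior {l : ℕ} {B : ℕ × List ℕ} (hB : B ∈ L) {b : Fin p.len → ℕ}
    (hb : ∀ s, b s ∈ B.2) :
    b ∈ p.blockOccurrences (assemble L) (l + 2) ↔ b ∈ p.blockOccurrences B.2 (l + 1) := by
  obtain ⟨c, hc⟩ := h.exists_offset_interior hB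
  have hfirst : ∀ s, firstPos (assemble L) (b s) = c + firstPos B.2 (b s) :=
    fun s => (hc _ (hb s)).1
  have hlast : ∀ s, lastPos (assemble L) (b s) = c + lastPos B.2 (b s) := fun s => (hc _ (hb s)).2
  simp only [PermPattern.blockOccurrences, Set.mem_ofPred_eq, StrictMono,
    h.isLevel_interior hB (hb _), h.areSiblings_interior hB (hb _), hfirst, hlast,
    Nat.add_lt_add_iff_left, add_assoc, Nat.add_left_cancel_iff]

lemma mem_blockOccurrences_add_two {l : ℕ} {b : Fin p.len → ℕ} :
    b ∈ p.blockOccurrences (assemble L) (l + 2) ↔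
      ∃ B ∈ L, b ∈ p.blockOccurrences B.2 (l + 1) := by
  constructor
  · intro hb
    obtain ⟨B, hB, hl⟩ := h.isLevel_add_two.1 (hb.2.1 ⟨0, hb.1⟩)
    refine ⟨B, hB, (h.mem_blockOccurrences_interior p hB fun s => ?_).1 hb⟩
    exact ((h.areSiblings_interior hB hl.mem).1 (hb.2.2.1 ⟨0, hb.1⟩ s)).mem_right
  · rintro ⟨B, hB, hb⟩
    exact (h.mem_blockOccurrences_interior p hB fun s => (hb.2.1 s).mem).2 hb

lemma levelCount_add_two (l : ℕ) :
    p.levelCount (assemble L) (l + 2) = ∑ m : Fin L.length, p.levelCount L[m].2 (l + 1) := by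
  have hunion : p.blockOccurrences (assemble L) (l + 2) =
      ⋃ m : Fin L.length, p.blockOccurrences L[m].2 (l + 1) := by
    ext b
    simp only [h.mem_blockOccurrences_add_two, Set.mem_iUnion, List.mem_iff_get]
    aesop
  rw [PermPattern.levelCount, hunion,
    Set.ncard_iUnion_of_finite fun m => finite_blockOccurrences p _ _, finsum_eq_sum_of_fintype]
  · rfl
  · exact fun m m' hne => Set.disjoint_left.2 fun b hb hb' =>
      h.disjoint_interior hne (hb.2.1 ⟨0, hb.1⟩).mem (hb'.2.1 ⟨0, hb.1⟩).mem

lemma mem_blockOccurrences_one {i : Fin p.len → Fin L.length} :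
    (fun s => L[i s].1) ∈ p.blockOccurrences (assemble L) 1 ↔
      i ∈ p.occurrences fun m : Fin L.length => L[m].1 := by
  have hlevel : ∀ m : Fin L.length, IsLevel (assemble L) 1 L[m].1 := fun m =>
    h.isLevel_one.2 ⟨_, List.getElem_mem m.2, rfl⟩
  have hsiblings : ∀ m m' : Fin L.length, AreSiblings (assemble L) L[m].1 L[m'].1 :=
    fun m m' => Or.inl ⟨hlevel m, hlevel m'⟩
  have hfirst : ∀ m m' : Fin L.length,
      firstPos (assemble L) L[m].1 < firstPos (assemble L) L[m'].1 ↔ m < m' := fun m m' => by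
    rw [Fin.getElem_fin, Fin.getElem_fin, h.firstPos_head m.2, h.firstPos_head m'.2,
      startPos_lt_startPos m'.2, Fin.lt_def]
  have hadj : ∀ m m' : Fin L.length,
      firstPos (assemble L) L[m'].1 = lastPos (assemble L) L[m].1 + 1 ↔ (m' : ℕ) = m + 1 :=
    fun m m' => by
      rw [Fin.getElem_fin, Fin.getElem_fin, h.firstPos_head m'.2, h.lastPos_head m.2,
        startPos_eq_startPos_succ m.2 m'.2]
  simp only [PermPattern.blockOccurrences, PermPattern.occurrences, Set.mem_ofPred_eq, StrictMono,
    hlevel, hsiblings, hfirst, hadj, implies_true, true_and]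

lemma levelCount_one :
    p.levelCount (assemble L) 1 = (p.occurrences fun m : Fin L.length => L[m].1).ncard := by
  have himage : p.blockOccurrences (assemble L) 1 =
      (fun i s => L[i s].1) '' (p.occurrences fun m : Fin L.length => L[m].1) := by
    refine Set.Subset.antisymm (fun b hb => ?_) ?_
    · have hhead : ∀ s, ∃ m : Fin L.length, L[m].1 = b s := fun s => by
        obtain ⟨B, hB, e⟩ := h.isLevel_one.1 (hb.2.1 s)
        obtain ⟨m, hm, rfl⟩ := List.getElem_of_mem hB
        exact ⟨⟨m, hm⟩, e.symm⟩
      choose i hi using hhead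
      obtain rfl : (fun s => L[i s].1) = b := funext hi
      exact ⟨i, (h.mem_blockOccurrences_one p).1 hb, rfl⟩
    · rintro _ ⟨i, hi, rfl⟩
      exact (h.mem_blockOccurrences_one p).2 hi
  rw [PermPattern.levelCount, himage]
  exact Set.ncard_image_of_injective _ h.head_injective.comp_left

end Separated

/-! ### Invariance under increasing relabelling -/

section Relabel
variable {φ : ℕ → ℕ}

section Injective
variable (hφ : Function.Injective φ) (w : List ℕ) (i j : ℕ)
include hφ

lemma idxOf_map : (w.map φ).idxOf (φ i) = w.idxOf i := by
  induction w with
  | nil => rfl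
  | cons a w ih =>
    by_cases e : a = i
    · rw [e, List.map_cons, List.idxOf_cons_self, List.idxOf_cons_self]
    · rw [List.map_cons, List.idxOf_cons_ne _ (hφ.ne e), List.idxOf_cons_ne _ e, ih]

lemma firstPos_map : firstPos (w.map φ) (φ i) = firstPos w i := idxOf_map hφ w i

lemma lastPos_map : lastPos (w.map φ) (φ i) = lastPos w i := by
  rw [lastPos, ← List.map_reverse, idxOf_map hφ, List.length_map, lastPos]

lemma inner_map : inner (w.map φ) (φ i) = (inner w i).map φ := by
  rw [inner, firstPos_map hφ, lastPos_map hφ, inner, List.map_drop, List.map_take]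

lemma blockSub_map : BlockSub (w.map φ) (φ i) (φ j) ↔ BlockSub w i j := by
  simp only [BlockSub, firstPos_map hφ, lastPos_map hφ, hφ.ne_iff]

lemma isLevelOne_map : IsLevelOne (w.map φ) (φ i) ↔ IsLevelOne w i := by
  simp only [IsLevelOne, List.forall_mem_map, List.mem_map_of_injective hφ, blockSub_map hφ]

lemma isLevel_map (l : ℕ) : IsLevel (w.map φ) l (φ i) ↔ IsLevel w l i := by
  induction l using Nat.strong_induction_on generalizing i with
  | _ l ih =>
  match l with
  | 0 => rfl
  | 1 => exact isLevelOne_map hφ w i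
  | l + 2 =>
    constructor
    · rintro ⟨j, hj, hs, hi⟩
      obtain ⟨j, -, rfl⟩ := List.mem_map.1 hj.mem
      rw [inner_map hφ, isLevelOne_map hφ] at hi
      exact ⟨j, (ih _ (by omega) _).1 hj, (blockSub_map hφ _ _ _).1 hs, hi⟩
    · rintro ⟨j, hj, hs, hi⟩
      refine ⟨φ j, (ih _ (by omega) _).2 hj, (blockSub_map hφ _ _ _).2 hs, ?_⟩
      rwa [inner_map hφ, isLevelOne_map hφ]

lemma isParent_map : IsParent (w.map φ) (φ j) (φ i) ↔ IsParent w j i := by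
  simp only [IsParent, blockSub_map hφ, isLevel_map hφ]

lemma areSiblings_map : AreSiblings (w.map φ) (φ i) (φ j) ↔ AreSiblings w i j := by
  simp only [AreSiblings, isLevel_map hφ]
  refine or_congr_right ⟨?_, ?_⟩
  · rintro ⟨k, hi, hj⟩
    obtain ⟨k, -, rfl⟩ := List.mem_map.1 hi.mem_parent
    exact ⟨k, (isParent_map hφ _ _ _).1 hi, (isParent_map hφ _ _ _).1 hj⟩
  · rintro ⟨k, hi, hj⟩
    exact ⟨φ k, (isParent_map hφ _ _ _).2 hi, (isParent_map hφ _ _ _).2 hj⟩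

lemma blockCount_map (l : ℕ) : blockCount (w.map φ) l = blockCount w l := by
  have himage : {i | IsLevel (w.map φ) l i} = φ '' {i | IsLevel w l i} := by
    refine Set.Subset.antisymm (fun j hj => ?_) ?_
    · obtain ⟨i, -, rfl⟩ := List.mem_map.1 (IsLevel.mem hj)
      exact ⟨i, (isLevel_map hφ _ _ _).1 hj, rfl⟩
    · rintro _ ⟨i, hi, rfl⟩
      exact (isLevel_map hφ _ _ _).2 hi
  rw [blockCount, himage, Set.ncard_image_of_injective _ hφ, blockCount]

end Injective

variable (hφ : StrictMono φ) (w : List ℕ) (p : PermPattern) (l : ℕ)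
include hφ

lemma comp_mem_blockOccurrences_map {b : Fin p.len → ℕ} :
    φ ∘ b ∈ p.blockOccurrences (w.map φ) l ↔ b ∈ p.blockOccurrences w l := by
  simp only [PermPattern.blockOccurrences, Set.mem_ofPred_eq, Function.comp_apply,
    isLevel_map hφ.injective, areSiblings_map hφ.injective, firstPos_map hφ.injective,
    lastPos_map hφ.injective, PermPattern.Matches, hφ.lt_iff_lt]

lemma levelCount_map : p.levelCount (w.map φ) l = p.levelCount w l := by
  have himage : p.blockOccurrences (w.map φ) l = (φ ∘ ·) '' p.blockOccurrences w l := by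
    refine Set.Subset.antisymm (fun b hb => ?_) ?_
    · have hrange : ∀ s, ∃ i, φ i = b s := fun s => by
        obtain ⟨i, -, e⟩ := List.mem_map.1 (hb.2.1 s).mem
        exact ⟨i, e⟩
      choose c hc using hrange
      obtain rfl : φ ∘ c = b := funext hc
      exact ⟨c, (comp_mem_blockOccurrences_map hφ w p l).1 hb, rfl⟩
    · rintro _ ⟨c, hc, rfl⟩
      exact (comp_mem_blockOccurrences_map hφ w p l).2 hc
  rw [PermPattern.levelCount, himage, Set.ncard_image_of_injective _ hφ.injective.comp_left,
    PermPattern.levelCount]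

end Relabel

/-! ### Stirling permutations and their blocks -/

/-- Stirling permutations of an arbitrary set of letters: every letter that occurs does so twice,
with only larger letters in between. -/
def IsStirlingPerm (σ : List ℕ) : Prop := (∀ i ∈ σ, σ.count i = 2) ∧ IsStirlingWord σ

/-- The set of Stirling permutations whose set of letters is `S`. -/
noncomputable def stirlingOn (S : Finset ℕ) : Finset (List ℕ) :=
  open Classical in (2 • S.val).lists.toFinset.filter IsStirlingWord

lemma stirlingPerms_eq_stirlingOn (n : ℕ) : stirlingPerms n = stirlingOn (Finset.Icc 1 n) := rfl

lemma mem_stirlingOn {S : Finset ℕ} {σ : List ℕ} :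
    σ ∈ stirlingOn S ↔ σ.toFinset = S ∧ IsStirlingPerm σ := by
  simp only [stirlingOn, Finset.mem_filter, Multiset.mem_toFinset, Multiset.mem_lists_iff,
    IsStirlingPerm, ← and_assoc]
  refine and_congr_left fun _ => ?_
  simp only [Multiset.quot_mk_to_coe, Multiset.ext, Multiset.count_nsmul, Multiset.coe_count]
  constructor
  · intro hcount
    have htoFinset : σ.toFinset = S := by
      ext i
      rw [List.mem_toFinset, ← List.count_pos_iff, ← Finset.mem_val, ← Multiset.count_pos]
      have := hcount i
      omega
    refine ⟨htoFinset, fun i hi => ?_⟩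
    rw [← hcount, Multiset.count_eq_one_of_mem S.nodup (by rwa [← htoFinset, Finset.mem_val,
      List.mem_toFinset]), mul_one]
  · rintro ⟨rfl, h⟩ i
    by_cases hi : i ∈ σ
    · rw [h i hi, Multiset.count_eq_one_of_mem (Finset.nodup _) (by simpa using hi)]
    · rw [List.count_eq_zero.2 hi, Multiset.count_eq_zero.2 (by simpa using hi)]

lemma isStirlingWord_iff_sublist {w : List ℕ} :
    IsStirlingWord w ↔ ∀ i j, [i, j, i].Sublist w → i < j := by
  constructor
  · intro h i j hs
    obtain ⟨is, e, his⟩ := List.sublist_eq_map_getElem hs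
    obtain ⟨a, b, c, rfl⟩ := List.length_eq_three.1 (by simpa using (congrArg List.length e).symm)
    simp only [List.map_cons, List.map_nil, List.cons.injEq, and_true] at e
    simp only [List.pairwise_cons, List.mem_cons, forall_eq_or_imp] at his
    exact h a b c i j his.1.1 his.2.1.1 (List.getElem?_eq_some_iff.2 ⟨a.2, e.1.symm⟩)
      (List.getElem?_eq_some_iff.2 ⟨c.2, e.2.2.symm⟩)
      (List.getElem?_eq_some_iff.2 ⟨b.2, e.2.1.symm⟩)
  · intro h a b c i j hab hbc ha hc hb
    obtain ⟨ha', rfl⟩ := List.getElem?_eq_some_iff.1 ha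
    obtain ⟨hb', rfl⟩ := List.getElem?_eq_some_iff.1 hb
    obtain ⟨hc', e⟩ := List.getElem?_eq_some_iff.1 hc
    have hs := List.map_getElem_sublist (l := w) (is := [⟨a, ha'⟩, ⟨b, hb'⟩, ⟨c, hc'⟩])
      (by simp [hab, hbc, hab.trans hbc])
    simp only [List.map_cons, List.map_nil, Fin.getElem_fin, e] at hs
    exact h _ _ hs

section Sublist
variable {u v l : List ℕ} {i : ℕ}

lemma cons_sublist_right_of_notMem (h : (i :: l).Sublist (u ++ v)) (hu : i ∉ u) :
    (i :: l).Sublist v := by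
  induction u with
  | nil => exact h
  | cons a u ih =>
    rw [List.mem_cons, not_or] at hu
    exact ih (h.of_cons_of_ne hu.1) hu.2

lemma concat_sublist_left_of_notMem (h : (l ++ [i]).Sublist (u ++ v)) (hv : i ∉ v) :
    (l ++ [i]).Sublist u := by
  rw [← List.reverse_sublist] at h ⊢
  simp only [List.reverse_append, List.reverse_singleton, List.singleton_append] at h ⊢
  exact cons_sublist_right_of_notMem h (mt List.mem_reverse.1 hv)

end Sublist

lemma isStirlingWord_append {u v : List ℕ} (hd : u.Disjoint v) :
    IsStirlingWord (u ++ v) ↔ IsStirlingWord u ∧ IsStirlingWord v := by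
  simp only [isStirlingWord_iff_sublist]
  refine ⟨fun h => ⟨fun i j hs => h i j (hs.trans (List.sublist_append_left _ _)),
    fun i j hs => h i j (hs.trans (List.sublist_append_right _ _))⟩, fun h i j hs => ?_⟩
  by_cases hi : i ∈ u
  · exact h.1 i j (concat_sublist_left_of_notMem (l := [i, j]) hs fun hv => hd hi hv)
  · exact h.2 i j (cons_sublist_right_of_notMem hs hi)

lemma isStirlingPerm_append {u v : List ℕ} (hd : u.Disjoint v) :
    IsStirlingPerm (u ++ v) ↔ IsStirlingPerm u ∧ IsStirlingPerm v := by
  have hu : ∀ i ∈ u, (u ++ v).count i = u.count i := fun i hi => by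
    rw [List.count_append, List.count_eq_zero.2 (hd hi), add_zero]
  have hv : ∀ i ∈ v, (u ++ v).count i = v.count i := fun i hi => by
    rw [List.count_append, List.count_eq_zero.2 fun hi' => hd hi' hi, zero_add]
  have hcount : (∀ i ∈ u ++ v, (u ++ v).count i = 2) ↔
      (∀ i ∈ u, u.count i = 2) ∧ ∀ i ∈ v, v.count i = 2 := by
    rw [List.forall_mem_append]
    exact and_congr (forall₂_congr fun i hi => by rw [hu i hi])
      (forall₂_congr fun i hi => by rw [hv i hi])
  rw [IsStirlingPerm, hcount, isStirlingWord_append hd, and_and_and_comm, IsStirlingPerm,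
    IsStirlingPerm]

lemma count_blockWord_head (B : ℕ × List ℕ) : (blockWord B).count B.1 = B.2.count B.1 + 2 := by
  rw [blockWord, List.count_cons_self, List.count_append, List.count_singleton_self]

lemma count_blockWord_of_ne {B : ℕ × List ℕ} {i : ℕ} (h : i ≠ B.1) :
    (blockWord B).count i = B.2.count i := by
  rw [blockWord, List.count_cons_of_ne h.symm, List.count_append,
    List.count_eq_zero.2 (mt List.mem_singleton.1 h), add_zero]

lemma isStirlingPerm_blockWord {B : ℕ × List ℕ} :
    IsStirlingPerm (blockWord B) ↔ IsStirlingPerm B.2 ∧ ∀ j ∈ B.2, B.1 < j := by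
  have hsub : B.2.Sublist (blockWord B) := (List.sublist_append_left _ _).cons _
  simp only [IsStirlingPerm, isStirlingWord_iff_sublist]
  constructor
  · rintro ⟨hcount, hword⟩
    have hlt : ∀ j ∈ B.2, B.1 < j := fun j hj => hword _ _ <| List.Sublist.cons_cons _ <|
      (List.singleton_sublist.2 hj).append (List.Sublist.refl [B.1])
    refine ⟨⟨fun i hi => ?_, fun i j hs => hword i j (hs.trans hsub)⟩, hlt⟩
    rw [← count_blockWord_of_ne (hlt i hi).ne', hcount i (mem_blockWord_of_mem hi)]
  · rintro ⟨⟨hcount, hword⟩, hlt⟩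
    have hhead : B.2.count B.1 = 0 := List.count_eq_zero.2 fun h => (hlt _ h).false
    refine ⟨fun i hi => ?_, fun i j hs => ?_⟩ <;> by_cases hi' : i = B.1
    · rw [hi', count_blockWord_head, hhead]
    · rw [count_blockWord_of_ne hi', hcount i ((mem_blockWord.1 hi).resolve_left hi')]
    · subst hi'
      refine hlt j ((mem_blockWord.1 (hs.subset (by simp))).resolve_left ?_)
      rintro rfl
      have := hs.count_le B.1
      rw [count_blockWord_head, hhead] at this
      simp at this
    · have hi'' : i ∉ [B.1] := mt List.mem_singleton.1 hi'
      refine hword i j (concat_sublist_left_of_notMem (l := [i, j]) ?_ hi'')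
      exact cons_sublist_right_of_notMem (u := [B.1]) hs hi''

lemma IsStirlingPerm.exists_eq_blockWord_append {b : ℕ} {rest : List ℕ}
    (h : IsStirlingPerm (b :: rest)) :
    ∃ w σ, b :: rest = blockWord (b, w) ++ σ ∧ (blockWord (b, w)).Disjoint σ := by
  have hcount := h.1 b List.mem_cons_self
  rw [List.count_cons_self] at hcount
  have hmem : b ∈ rest := List.count_pos_iff.1 (by omega)
  obtain ⟨w, σ, rfl, hbw⟩ := List.eq_append_cons_of_mem hmem
  rw [List.count_append, List.count_cons_self] at hcount
  have hbσ : b ∉ σ := List.count_eq_zero.1 (by omega)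
  refine ⟨w, σ, by simp [blockWord], fun i hi hi' => ?_⟩
  have hword := isStirlingWord_iff_sublist.1 h.2
  rcases mem_blockWord.1 hi with rfl | hiw
  · exact hbσ hi'
  · have hiw' := List.singleton_sublist.2 hiw
    have hbi : b < i := hword b i <| List.Sublist.cons_cons _ <|
      hiw'.append (r₁ := [b]) (by simp)
    have hib : i < b := hword i b <| List.Sublist.cons _ <|
      hiw'.append (r₁ := [b, i]) (by simpa using hi')
    exact hbi.asymm hib

lemma separated_nil : Separated [] := ⟨by simp, List.Pairwise.nil⟩

lemma separated_cons {B : ℕ × List ℕ} {L : List (ℕ × List ℕ)} : Separated (B :: L) ↔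
    B.1 ∉ B.2 ∧ (blockWord B).Disjoint (assemble L) ∧ Separated L := by
  have hdisjoint : (blockWord B).Disjoint (assemble L) ↔
      ∀ C ∈ L, (blockWord B).Disjoint (blockWord C) :=
    ⟨fun h C hC i hi hi' => h hi (mem_assemble.2 ⟨C, hC, hi'⟩), fun h i hi hi' =>
      let ⟨C, hC, hiC⟩ := mem_assemble.1 hi'
      h C hC hi hiC⟩
  constructor
  · rintro ⟨hhead, hpair⟩
    rw [List.pairwise_cons] at hpair
    rw [List.forall_mem_cons] at hhead
    exact ⟨hhead.1, hdisjoint.2 hpair.1, hhead.2, hpair.2⟩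
  · rintro ⟨hB, hd, hhead, hpair⟩
    exact ⟨List.forall_mem_cons.2 ⟨hB, hhead⟩, List.pairwise_cons.2 ⟨hdisjoint.1 hd, hpair⟩⟩

lemma Separated.isStirlingPerm_assemble {L : List (ℕ × List ℕ)} (h : Separated L) :
    IsStirlingPerm (assemble L) ↔ ∀ B ∈ L, IsStirlingPerm (blockWord B) := by
  induction L with
  | nil => simp [IsStirlingPerm, IsStirlingWord, assemble]
  | cons B L ih =>
    obtain ⟨-, hd, hL⟩ := separated_cons.1 h
    rw [List.forall_mem_cons, ← ih hL]
    exact isStirlingPerm_append hd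

lemma IsStirlingPerm.exists_assemble_eq {σ : List ℕ} (h : IsStirlingPerm σ) :
    ∃ L, Separated L ∧ assemble L = σ := by
  induction hn : σ.length using Nat.strong_induction_on generalizing σ with
  | _ n ih =>
  match σ with
  | [] => exact ⟨[], separated_nil, rfl⟩
  | b :: rest =>
    obtain ⟨w, τ, e, hd⟩ := h.exists_eq_blockWord_append
    rw [e, List.length_append, length_blockWord] at hn
    rw [e] at h ⊢
    obtain ⟨hw, hτ⟩ := (isStirlingPerm_append hd).1 h
    obtain ⟨L, hL, rfl⟩ := ih τ.length (by omega) hτ rfl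
    have hb : b ∉ w := fun hb => ((isStirlingPerm_blockWord.1 hw).2 b hb).false
    exact ⟨(b, w) :: L, separated_cons.2 ⟨hb, hd, hL⟩, rfl⟩

lemma Separated.eq_of_assemble_eq {L M : List (ℕ × List ℕ)} (hL : Separated L) (hM : Separated M)
    (e : assemble L = assemble M) : L = M := by
  induction L generalizing M with
  | nil =>
    cases M with
    | nil => rfl
    | cons C M => simp [assemble, blockWord] at e
  | cons B L ih =>
    cases M with
    | nil => simp [assemble, blockWord] at e
    | cons C M =>
      obtain ⟨b, w⟩ := B
      obtain ⟨c, v⟩ := C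
      obtain ⟨hb, -, hL'⟩ := separated_cons.1 hL
      obtain ⟨hc, -, hM'⟩ := separated_cons.1 hM
      simp only [assemble, blockWord, List.flatMap_cons, List.cons_append, List.append_assoc,
        List.cons.injEq, List.nil_append] at e
      obtain ⟨rfl, e⟩ := e
      have hlen : w.length = v.length := by
        have := congrArg (List.idxOf b) e
        simpa [List.idxOf_append_of_notMem hb, List.idxOf_append_of_notMem hc] using this
      obtain ⟨rfl, e'⟩ := List.append_inj e hlen
      rw [ih hL' hM' (List.cons.inj e').2]

section Relabel
variable {φ : ℕ → ℕ} (hφ : StrictMono φ)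
include hφ

lemma isStirlingPerm_map {w : List ℕ} : IsStirlingPerm (w.map φ) ↔ IsStirlingPerm w := by
  simp only [IsStirlingPerm, List.forall_mem_map, List.count_map_of_injective _ _ hφ.injective]
  refine and_congr_right fun _ => ⟨fun h a b c i j hab hbc ha hc hb => ?_, ?_⟩
  · exact hφ.lt_iff_lt.1 (h a b c _ _ hab hbc (by simp [ha]) (by simp [hc]) (by simp [hb]))
  · intro h a b c i j hab hbc ha hc hb
    simp only [List.getElem?_map, Option.map_eq_some_iff] at ha hb hc
    obtain ⟨i, ha, rfl⟩ := ha
    obtain ⟨i', hc, e⟩ := hc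
    obtain ⟨j, hb, rfl⟩ := hb
    exact hφ (h a b c i j hab hbc ha (hφ.injective e ▸ hc) hb)

lemma stirlingOn_image (S : Finset ℕ) :
    stirlingOn (S.image φ) = (stirlingOn S).image (List.map φ) := by
  have htoFinset : ∀ v : List ℕ, (v.map φ).toFinset = v.toFinset.image φ := fun v => by
    ext
    simp
  ext w
  rw [Finset.mem_image]
  constructor
  · intro hw
    rw [mem_stirlingOn] at hw
    have hrange : w ∈ Set.range (List.map φ) := by
      rw [Set.range_list_map]
      intro i hi
      obtain ⟨j, -, rfl⟩ := Finset.mem_image.1 (hw.1 ▸ List.mem_toFinset.2 hi)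
      exact ⟨j, rfl⟩
    obtain ⟨v, rfl⟩ := hrange
    rw [htoFinset, isStirlingPerm_map hφ] at hw
    exact ⟨v, mem_stirlingOn.2 ⟨Finset.image_injective hφ.injective hw.1, hw.2⟩, rfl⟩
  · rintro ⟨v, hv, rfl⟩
    rw [mem_stirlingOn] at hv ⊢
    rwa [htoFinset, isStirlingPerm_map hφ, (Finset.image_injective hφ.injective).eq_iff]

end Relabel

lemma exists_strictMono_image_Icc {T : Finset ℕ} (h0 : 0 ∉ T) :
    ∃ φ : ℕ → ℕ, StrictMono φ ∧ (Finset.Icc 1 T.card).image φ = T := by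
  classical
  -- `φ` enumerates `0`, then `T`, then the numbers above `T`.
  let P : ℕ → Prop := fun k => k = 0 ∨ k ∈ T ∨ T.sup id < k
  have hinf : (Set.ofPred P).Infinite := Set.infinite_of_not_bddAbove fun ⟨a, ha⟩ => by
    have : T.sup id + a + 1 ≤ a := ha (Or.inr (Or.inr (by omega)))
    omega
  refine ⟨Nat.nth P, Nat.nth_strictMono hinf, (Finset.eq_of_subset_of_card_le ?_ ?_).symm⟩
  · intro k hk
    refine Finset.mem_image.2 ⟨Nat.count P k, Finset.mem_Icc.2 ⟨?_, ?_⟩,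
      Nat.nth_count (Or.inr (Or.inl hk))⟩ <;> rw [Nat.count_eq_card_filter_range]
    · have hk0 : 0 < k := Nat.pos_of_ne_zero fun e => h0 (e ▸ hk)
      exact Finset.card_pos.2 ⟨0, by simp [P, hk0]⟩
    · have hsub : (Finset.range k).filter P ⊆ insert 0 (T.erase k) := fun i hi => by
        have hle : k ≤ T.sup id := Finset.le_sup (f := id) hk
        simp only [P, Finset.mem_filter, Finset.mem_range] at hi
        simp only [Finset.mem_insert, Finset.mem_erase]
        exact hi.2.imp_right fun h => ⟨hi.1.ne, h.resolve_right (by omega)⟩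
      refine (Finset.card_le_card hsub).trans ((Finset.card_insert_le _ _).trans ?_)
      rw [Finset.card_erase_add_one hk]
  · exact Finset.card_image_le.trans (by simp)

/-! ### Weights of words and of permutations -/

section OrderWeight
variable {R : Type*} [CommRing R] (A : Set PermPattern) (p : PermPattern) (z : R)

open Classical in
/-- The summand in `fCoeff` of a permutation, given as a word of distinct letters; it is `0` for
a permutation containing a pattern to be avoided. -/
noncomputable def orderWeight {α : Type*} [LinearOrder α] {n : ℕ} (w : Fin n → α) : R :=
  if ∀ a ∈ A, (a.occurrences w).ncard = 0 then z ^ (p.occurrences w).ncard else 0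

lemma fCoeff_eq_sum_orderWeight (n : ℕ) :
    fCoeff A p n z = ∑ π : Equiv.Perm (Fin n), orderWeight A p z π := by
  classical exact Finset.sum_filter _ _

lemma orderWeight_congr {α β : Type*} [LinearOrder α] [LinearOrder β]
    {n : ℕ} {w : Fin n → α} {v : Fin n → β} (h : ∀ s t, w s < w t ↔ v s < v t) :
    orderWeight A p z w = orderWeight A p z v := by
  have hocc : ∀ q : PermPattern, q.occurrences w = q.occurrences v := fun q => by
    simp only [PermPattern.occurrences, PermPattern.Matches, h]
  classical
  exact if_congr (by simp only [hocc]) (by rw [hocc]) rfl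

lemma sum_orderWeight_equiv {ι : Type*} [Fintype ι] [DecidableEq ι]
    {k : ℕ} (hk : Fintype.card ι = k) {b : ι → ℕ} (hb : Function.Injective b) :
    ∑ e : Fin k ≃ ι, orderWeight A p z (b ∘ e) = fCoeff A p k z := by
  let _ : LinearOrder ι := LinearOrder.lift' b hb
  let r : Fin k ≃o ι := Fintype.orderIsoFinOfCardEq ι hk
  have hr : ∀ s t, b (r s) < b (r t) ↔ s < t := fun s t => r.lt_iff_lt
  rw [fCoeff_eq_sum_orderWeight]
  refine (Fintype.sum_equiv ((Equiv.refl _).equivCongr r.toEquiv) _ _ fun π => ?_).symm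
  exact orderWeight_congr _ _ _ fun s t => (hr _ _).symm

end OrderWeight

section WordWeight
variable {R : Type*} [CommRing R] (A : ℕ → Set PermPattern) (p : ℕ → PermPattern) (x y : ℕ → R)

open Classical in
/-- The summand of the word `σ` in `gCoeff`, which is `0` for a word containing a pattern to be
avoided. -/
noncomputable def wordWeight (σ : List ℕ) : R :=
  if ∀ i, ∀ a ∈ A i, a.levelCount σ (i + 1) = 0 then
    ∏ᶠ i : ℕ, x i ^ (p i).levelCount σ (i + 1) * y i ^ blockCount σ (i + 1) else 0

lemma gCoeff_eq_sum_wordWeight (n : ℕ) :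
    gCoeff A p n x y = ∑ σ ∈ stirlingOn (Finset.Icc 1 n), wordWeight A p x y σ := by
  simp only [gCoeff, stirlingAvoiding, Finset.sum_filter, wordWeight, stirlingPerms_eq_stirlingOn]

lemma wordWeight_map {φ : ℕ → ℕ} (hφ : StrictMono φ) (σ : List ℕ) :
    wordWeight A p x y (σ.map φ) = wordWeight A p x y σ := by
  classical
  exact if_congr (by simp only [levelCount_map hφ])
    (by simp only [levelCount_map hφ, blockCount_map hφ.injective]) rfl

lemma sum_wordWeight_stirlingOn {T : Finset ℕ} (h0 : 0 ∉ T) :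
    ∑ σ ∈ stirlingOn T, wordWeight A p x y σ = gCoeff A p T.card x y := by
  obtain ⟨φ, hφ, hT⟩ := exists_strictMono_image_Icc h0
  conv_lhs => rw [← hT, stirlingOn_image hφ]
  rw [Finset.sum_image (List.map_injective_iff.2 hφ.injective).injOn, gCoeff_eq_sum_wordWeight]
  exact Finset.sum_congr rfl fun σ _ => wordWeight_map A p x y hφ σ

lemma finprod_levels_eq_prod_range {σ : List ℕ} {N : ℕ} (h : σ.length ≤ N) :
    ∏ᶠ i : ℕ, x i ^ (p i).levelCount σ (i + 1) * y i ^ blockCount σ (i + 1) =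
      ∏ i ∈ Finset.range N, x i ^ (p i).levelCount σ (i + 1) * y i ^ blockCount σ (i + 1) := by
  refine finprod_eq_prod_of_mulSupport_subset _ fun i hi => ?_
  by_contra hn
  have hlt : σ.length < i + 1 := by
    rw [Finset.coe_range, Set.mem_Iio] at hn
    omega
  refine hi ?_
  simp only [levelCount_of_length_lt (p i) hlt, blockCount_of_length_lt hlt, pow_zero, mul_one]

section Separated
variable {L : List (ℕ × List ℕ)} (h : Separated L)
include h

lemma Separated.avoids_iff : (∀ i, ∀ a ∈ A i, a.levelCount (assemble L) (i + 1) = 0) ↔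
    (∀ a ∈ A 0, (a.occurrences fun m : Fin L.length => L[m].1).ncard = 0) ∧
      ∀ m : Fin L.length, ∀ i, ∀ a ∈ shift A i, a.levelCount L[m].2 (i + 1) = 0 := by
  have hsum : ∀ i (a : PermPattern), a.levelCount (assemble L) (i + 2) = 0 ↔
      ∀ m : Fin L.length, a.levelCount L[m].2 (i + 1) = 0 := fun i a => by
    simp only [h.levelCount_add_two, Finset.sum_eq_zero_iff, Finset.mem_univ, true_imp_iff]
  rw [← Nat.and_forall_add_one]
  simp only [h.levelCount_one, add_assoc, Nat.reduceAdd, zero_add, hsum, shift]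
  exact and_congr_right fun _ => ⟨fun H m i a ha => H i a ha m, fun H i a ha m => H m i a ha⟩

lemma Separated.finprod_levels :
    ∏ᶠ i : ℕ, x i ^ (p i).levelCount (assemble L) (i + 1) *
        y i ^ blockCount (assemble L) (i + 1) =
      x 0 ^ ((p 0).occurrences fun m : Fin L.length => L[m].1).ncard * y 0 ^ L.length *
        ∏ m : Fin L.length, ∏ᶠ i : ℕ, shift x i ^ (shift p i).levelCount L[m].2 (i + 1) *
          shift y i ^ blockCount L[m].2 (i + 1) := by
  have hinterior : ∀ m : Fin L.length,
      ∏ᶠ i : ℕ, shift x i ^ (shift p i).levelCount L[m].2 (i + 1) *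
          shift y i ^ blockCount L[m].2 (i + 1) =
        ∏ i ∈ Finset.range (assemble L).length, x (i + 1) ^ (p (i + 1)).levelCount L[m].2 (i + 1) *
          y (i + 1) ^ blockCount L[m].2 (i + 1) := fun m =>
    finprod_levels_eq_prod_range _ _ _ (h.length_interior_le (List.getElem_mem m.2))
  rw [finprod_levels_eq_prod_range p x y (Nat.le_succ _), Finset.prod_range_succ', mul_comm,
    zero_add, h.levelCount_one, h.blockCount_one, Fintype.prod_congr _ _ hinterior,
    Finset.prod_comm]
  congr 1
  refine Finset.prod_congr rfl fun i _ => ?_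
  rw [add_assoc, h.levelCount_add_two, h.blockCount_add_two, Finset.prod_mul_distrib,
    Finset.prod_pow_eq_pow_sum, Finset.prod_pow_eq_pow_sum]

lemma Separated.wordWeight_assemble : wordWeight A p x y (assemble L) =
    orderWeight (A 0) (p 0) (x 0) (fun m : Fin L.length => L[m].1) * y 0 ^ L.length *
      ∏ m : Fin L.length, wordWeight (shift A) (shift p) (shift x) (shift y) L[m].2 := by
  classical
  simp only [wordWeight, orderWeight]
  rw [if_congr (h.avoids_iff A) (h.finprod_levels p x y) rfl, Fintype.prod_ite_zero, ite_and,
    ite_mul, ite_mul, mul_ite, zero_mul, zero_mul, mul_zero]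
  congr

end Separated

lemma wordWeight_assemble_ofFn {k : ℕ} {B : Fin k → ℕ × List ℕ} (h : Separated (List.ofFn B)) :
    wordWeight A p x y (assemble (List.ofFn B)) =
      orderWeight (A 0) (p 0) (x 0) (fun m => (B m).1) * y 0 ^ k *
        ∏ m, wordWeight (shift A) (shift p) (shift x) (shift y) (B m).2 := by
  obtain ⟨L, hL⟩ := List.equivSigmaTuple.surjective ⟨k, B⟩
  cases hL
  rw [List.ofFn_get] at h ⊢
  exact h.wordWeight_assemble A p x y

end WordWeight

/-! ### Set partitions of a given type -/

section SetPartition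
variable {α M : Type*} [DecidableEq α] [AddCommMonoid M]

lemma sup_erase_part {S U : Finset α} (P : Finpartition S) (hU : U ∈ P.parts) :
    (P.parts.erase U).sup id = S \ U := by
  have hdisj : Disjoint U ((P.parts.erase U).sup id) :=
    P.supIndep (Finset.erase_subset _ _) hU (Finset.notMem_erase _ _)
  have hunion : U ∪ (P.parts.erase U).sup id = S :=
    calc U ∪ (P.parts.erase U).sup id = (insert U (P.parts.erase U)).sup id :=
          (Finset.sup_insert (f := id)).symm
      _ = S := by rw [Finset.insert_erase hU, P.sup_parts]
  exact (Finset.union_sdiff_cancel_left hdisj).symm.trans (congrArg (· \ U) hunion)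

lemma insert_notMem_parts {a : α} {S : Finset α} (ha : a ∉ S) (P : Finpartition S)
    (U : Finset α) : insert a U ∉ P.parts := fun hU => ha (P.le hU (Finset.mem_insert_self a U))

lemma sum_finpartition_insert {a : α} {T : Finset α} (ha : a ∉ T)
    (Φ : Finset (Finset α) → M) :
    ∑ P : Finpartition (insert a T), Φ P.parts =
      ∑ U ∈ T.powerset, ∑ Q : Finpartition (T \ U), Φ (insert (insert a U) Q.parts) := by
  have hnotMem : ∀ U, a ∉ T \ U := fun U h => ha (Finset.mem_sdiff.1 h).1
  have hdisj : ∀ U : Finset α, Disjoint (T \ U) (insert a U) := fun U =>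
    Finset.disjoint_insert_right.2 ⟨hnotMem U, Finset.sdiff_disjoint⟩
  have hunion : ∀ U ∈ T.powerset, T \ U ⊔ insert a U = insert a T := fun U hU => by
    rw [Finset.sup_eq_union, Finset.union_insert,
      Finset.sdiff_union_of_subset (Finset.mem_powerset.1 hU)]
  rw [Finset.sum_sigma']
  symm
  refine Finset.sum_bij (fun UQ h => UQ.2.extend (Finset.insert_ne_empty a UQ.1) (hdisj UQ.1)
    (hunion UQ.1 (Finset.mem_sigma.1 h).1)) (fun _ _ => Finset.mem_univ _) ?_ ?_ fun _ _ => rfl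
  · rintro ⟨U, Q⟩ hU ⟨U', Q'⟩ hU' h
    simp only [Finset.mem_sigma, Finset.mem_powerset, Finset.mem_univ, and_true] at hU hU'
    have hparts : insert (insert a U) Q.parts = insert (insert a U') Q'.parts :=
      congrArg Finpartition.parts h
    have hpart : insert a U = insert a U' := by
      have hmem : insert a U' ∈ insert (insert a U) Q.parts :=
        hparts ▸ Finset.mem_insert_self _ _
      exact ((Finset.mem_insert.1 hmem).resolve_right (insert_notMem_parts (hnotMem U) Q U')).symm
    obtain rfl : U = U' := by
      rw [← Finset.erase_insert fun h => ha (hU h), hpart,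
        Finset.erase_insert fun h => ha (hU' h)]
    obtain rfl : Q = Q' := Finpartition.ext <| by
      rw [← Finset.erase_insert (insert_notMem_parts (hnotMem U) Q U), hparts,
        Finset.erase_insert (insert_notMem_parts (hnotMem U) Q' U)]
    rfl
  · intro P _
    have haP : a ∈ P.part a := P.mem_part_self.2 (Finset.mem_insert_self a T)
    have hP : P.part a ∈ P.parts := P.part_mem.2 (Finset.mem_insert_self a T)
    have hsup : (P.parts.erase (P.part a)).sup id = T \ (P.part a).erase a := by
      rw [sup_erase_part P hP]
      grind
    refine ⟨⟨(P.part a).erase a, P.ofSubset (Finset.erase_subset _ _) hsup⟩, ?_, ?_⟩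
    · simp only [Finset.mem_sigma, Finset.mem_powerset, Finset.mem_univ, and_true]
      exact (Finset.erase_subset_erase a (P.part_subset a)).trans (Finset.erase_insert ha).le
    · refine Finpartition.ext ?_
      change insert (insert a ((P.part a).erase a)) (P.parts.erase (P.part a)) = P.parts
      rw [Finset.insert_erase haP, Finset.insert_erase hP]

lemma sum_partition_succ (n : ℕ) (F : Multiset ℕ → M) :
    ∑ lam : (n + 1).Partition, lam.parts.bell • F lam.parts =
      ∑ i ∈ Finset.range (n + 1), n.choose i •
        ∑ mu : (n - i).Partition, mu.parts.bell • F ((i + 1) ::ₘ mu.parts) := by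
  have hpart : ∀ i ∈ Finset.range (n + 1),
      ∑ mu : (n - i).Partition, mu.parts.bell • F ((i + 1) ::ₘ mu.parts) =
      ∑ lam : (n + 1).Partition with i + 1 ∈ lam.parts,
        (lam.parts.erase (i + 1)).bell • F lam.parts := fun i hi => by
    have hi' : i + 1 ≤ n + 1 := Finset.mem_range.1 hi
    rw [← Nat.add_sub_add_right n 1 i, Finset.sum_subtype _ fun lam => Finset.mem_filter_univ lam]
    refine (Fintype.sum_equiv (Nat.Partition.partitionWithPartEquiv (Nat.le_add_left 1 i) hi')
      _ _ fun lam => ?_).symm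
    rw [Nat.Partition.partitionWithPartEquiv_apply_parts, Multiset.cons_erase lam.2]
  calc ∑ lam : (n + 1).Partition, lam.parts.bell • F lam.parts
    _ = ∑ lam : (n + 1).Partition, ∑ k ∈ lam.parts.toFinset,
          n.choose (k - 1) • (lam.parts.erase k).bell • F lam.parts := by
        simp only [Nat.bell_eq_sum_erase, Finset.sum_smul, mul_smul]
    _ = ∑ k ∈ Finset.Ico (0 + 1) (n + 1 + 1), ∑ lam : (n + 1).Partition with k ∈ lam.parts,
          n.choose (k - 1) • (lam.parts.erase k).bell • F lam.parts := by
        refine Finset.sum_comm' fun lam k => ?_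
        have hle : k ∈ lam.parts → 1 ≤ k ∧ k < n + 2 := fun hk =>
          ⟨lam.parts_pos hk, Nat.lt_succ_of_le (lam.le_of_mem_parts hk)⟩
        simp only [Finset.mem_univ, true_and, Multiset.mem_toFinset, Finset.mem_filter,
          Finset.mem_Ico, zero_add]
        exact ⟨fun hk => ⟨hk, hle hk⟩, And.left⟩
    _ = _ := by
        rw [← Finset.sum_Ico_add', ← Finset.range_eq_Ico]
        refine Finset.sum_congr rfl fun i hi => ?_
        rw [hpart i hi, Finset.smul_sum, Nat.add_sub_cancel]

theorem sum_finpartition_eq_sum_partition (F : Multiset ℕ → M) {n : ℕ} {S : Finset α}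
    (hS : S.card = n) :
    ∑ P : Finpartition S, F (P.parts.val.map Finset.card) =
      ∑ lam : n.Partition, lam.parts.bell • F lam.parts := by
  induction n using Nat.strong_induction_on generalizing S F with
  | _ n ih =>
    rcases n with _ | n
    · obtain rfl := Finset.card_eq_zero.1 hS
      let _ : Unique (Finpartition (∅ : Finset α)) :=
        inferInstanceAs (Unique (Finpartition (⊥ : Finset α)))
      have hparts : (default : Finpartition (∅ : Finset α)).parts = ∅ :=
        Finpartition.parts_eq_empty_iff.2 rfl
      simp [hparts]
    · obtain ⟨a, T, ha, rfl, hT⟩ := Finset.card_eq_succ.1 hS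
      have hnotMem : ∀ U, a ∉ T \ U := fun U h => ha (Finset.mem_sdiff.1 h).1
      have hval : ∀ U ∈ T.powerset, ∀ Q : Finpartition (T \ U),
          (insert (insert a U) Q.parts).val.map Finset.card =
            (U.card + 1) ::ₘ Q.parts.val.map Finset.card := fun U hU Q => by
        rw [Finset.insert_val_of_notMem (insert_notMem_parts (hnotMem U) Q U), Multiset.map_cons,
          Finset.card_insert_of_notMem fun h => ha (Finset.mem_powerset.1 hU h)]
      rw [sum_finpartition_insert ha fun parts => F (parts.val.map Finset.card),
        sum_partition_succ, ← hT, ← Finset.sum_powerset_apply_card]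
      refine Finset.sum_congr rfl fun U hU => ?_
      rw [Fintype.sum_congr _ _ fun Q => congrArg F (hval U hU Q)]
      exact ih _ (by omega) (fun m => F ((U.card + 1) ::ₘ m))
        (Finset.card_sdiff_of_subset (Finset.mem_powerset.1 hU))

end SetPartition

lemma cast_bell {n : ℕ} (lam : n.Partition) : (lam.parts.bell : ℚ) =
    ((n.factorial : ℚ) / (lam.parts.map (fun k => (k.factorial : ℚ))).prod) /
      (∏ i ∈ Finset.Icc 1 n, ((lam.parts.count i).factorial : ℚ)) := by
  have hcount : ∏ i ∈ lam.parts.toFinset.erase 0, (lam.parts.count i).factorial =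
      ∏ i ∈ Finset.Icc 1 n, (lam.parts.count i).factorial := by
    refine Finset.prod_subset (fun i hi => ?_) fun i hi hn => ?_
    · rw [Finset.mem_erase, Multiset.mem_toFinset] at hi
      exact Finset.mem_Icc.2 ⟨lam.parts_pos hi.2, lam.le_of_mem_parts hi.2⟩
    · have hi0 : i ≠ 0 := Nat.one_le_iff_ne_zero.1 (Finset.mem_Icc.1 hi).1
      rw [Finset.mem_erase, Multiset.mem_toFinset] at hn
      rw [Multiset.count_eq_zero_of_notMem fun hmem => hn ⟨hi0, hmem⟩, Nat.factorial_zero]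
  have hprod : (lam.parts.map fun k => (k.factorial : ℚ)).prod =
      ((lam.parts.map Nat.factorial).prod : ℕ) := by
    rw [Nat.cast_multiset_prod, Multiset.map_map]
    rfl
  have hbell := lam.parts.bell_mul_eq
  rw [hcount, lam.parts_sum] at hbell
  have hparts : (lam.parts.map Nat.factorial).prod ≠ 0 := fun h =>
    n.factorial_ne_zero (by rw [← hbell, h, mul_zero, zero_mul])
  have hmult : ∏ i ∈ Finset.Icc 1 n, (lam.parts.count i).factorial ≠ 0 := fun h =>
    n.factorial_ne_zero (by rw [← hbell, h, mul_zero])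
  rw [hprod, div_div, eq_div_iff (mod_cast mul_ne_zero hparts hmult), ← mul_assoc]
  exact_mod_cast hbell

/-! ### Decomposition into level 1 blocks -/

/-- The smallest element of `U`, which is the outer letter of a block with set of letters `U`
(and `0` if `U` is empty). -/
noncomputable def leader (U : Finset ℕ) : ℕ := sInf (U : Set ℕ)

lemma leader_mem {U : Finset ℕ} (hU : U.Nonempty) : leader U ∈ U := Nat.sInf_mem hU

lemma blockWord_mem_stirlingOn {B : ℕ × List ℕ} {U : Finset ℕ} : blockWord B ∈ stirlingOn U ↔
    U.Nonempty ∧ B.1 = leader U ∧ B.2 ∈ stirlingOn (U.erase (leader U)) := by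
  have hletters : (blockWord B).toFinset = insert B.1 B.2.toFinset := by
    ext i
    rw [List.mem_toFinset, mem_blockWord, Finset.mem_insert, List.mem_toFinset]
  rw [mem_stirlingOn, mem_stirlingOn, isStirlingPerm_blockWord, hletters]
  constructor
  · rintro ⟨rfl, hinner, hlt⟩
    have hleader : leader (insert B.1 B.2.toFinset) = B.1 := by
      refine IsLeast.csInf_eq ⟨Finset.mem_insert_self _ _, fun i hi => ?_⟩
      rcases Finset.mem_insert.1 hi with rfl | hi
      · exact le_rfl
      · exact (hlt i (List.mem_toFinset.1 hi)).le
    have hnotMem : B.1 ∉ B.2.toFinset := fun h => (hlt _ (List.mem_toFinset.1 h)).false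
    rw [hleader, Finset.erase_insert hnotMem]
    exact ⟨Finset.insert_nonempty _ _, rfl, rfl, hinner⟩
  · rintro ⟨hU, hB, hletters', hinner⟩
    rw [hB, hletters', Finset.insert_erase (leader_mem hU)]
    refine ⟨rfl, hinner, fun j hj => ?_⟩
    rw [← List.mem_toFinset, hletters', Finset.mem_erase] at hj
    exact lt_of_le_of_ne (Nat.sInf_le hj.2) hj.1.symm

lemma injective_leader_parts {S : Finset ℕ} (P : Finpartition S) :
    Function.Injective fun U : P.parts => leader U := fun U V h =>
  Subtype.ext <| P.eq_of_mem_parts U.2 V.2 (leader_mem (P.nonempty_of_mem_parts U.2)) <|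
    (congrArg (· ∈ V.1) h).mpr (leader_mem (P.nonempty_of_mem_parts V.2))

lemma mem_assemble_ofFn {k : ℕ} {B : Fin k → ℕ × List ℕ} {i : ℕ} :
    i ∈ assemble (List.ofFn B) ↔ ∃ j, i ∈ blockWord (B j) := by
  simp only [mem_assemble, List.mem_ofFn, exists_exists_eq_and]

lemma exists_finpartition_equiv {α ι : Type*} [DecidableEq α] [Finite ι] {S : Finset α}
    {V : ι → Finset α} (hne : ∀ j, (V j).Nonempty) (hsub : ∀ j, V j ⊆ S)
    (huniq : ∀ a ∈ S, ∃! j, a ∈ V j) :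
    ∃ (P : Finpartition S) (e : ι ≃ P.parts), ∀ j, (e j : Finset α) = V j := by
  cases nonempty_fintype ι
  have hV : ∀ {i j a}, a ∈ V i → a ∈ V j → i = j := fun {i _ _} hi hj =>
    (huniq _ (hsub i hi)).unique hi hj
  let P : Finpartition S := Finpartition.ofExistsUnique (Finset.univ.image V)
    (Finset.forall_mem_image.2 fun j _ => hsub j)
    (fun a ha => by
      obtain ⟨j, hj, -⟩ := huniq a ha
      refine ⟨V j, ⟨Finset.mem_image_of_mem V (Finset.mem_univ j), hj⟩, ?_⟩
      rintro U ⟨hU, haU⟩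
      obtain ⟨i, -, rfl⟩ := Finset.mem_image.1 hU
      rw [hV haU hj])
    (fun hempty => by
      obtain ⟨j, -, hj⟩ := Finset.mem_image.1 hempty
      exact (hne j).ne_empty hj)
  have hmem : ∀ j, V j ∈ P.parts := fun j => Finset.mem_image_of_mem V (Finset.mem_univ j)
  refine ⟨P, Equiv.ofBijective (fun j => ⟨V j, hmem j⟩) ⟨fun i j hij => ?_, fun U => ?_⟩,
    fun j => rfl⟩
  · obtain ⟨a, ha⟩ := hne i
    exact hV ha (congrArg (a ∈ ·.1) hij ▸ ha)
  · obtain ⟨j, -, hj⟩ := Finset.mem_image.1 U.2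
    exact ⟨j, Subtype.ext hj⟩

section Blocks
variable {S : Finset ℕ} {P : Finpartition S} {k : ℕ} {e : Fin k ≃ P.parts} {w : P.parts → List ℕ}

/-- The blocks whose sets of letters are the parts of `P`, listed in the order `e` and with
interiors `w`. -/
noncomputable def blocks (e : Fin k ≃ P.parts) (w : P.parts → List ℕ) (j : Fin k) :
    ℕ × List ℕ := (leader (e j), w (e j))

/-- The possible interiors of blocks whose sets of letters are the parts of `P`. -/
noncomputable def interiors (P : Finpartition S) : Finset (P.parts → List ℕ) :=
  Fintype.piFinset fun U => stirlingOn (U.1.erase (leader U))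

lemma blockWord_blocks_mem_stirlingOn (e : Fin k ≃ P.parts) (hw : w ∈ interiors P) (j : Fin k) :
    blockWord (blocks e w j) ∈ stirlingOn (e j) :=
  blockWord_mem_stirlingOn.2 ⟨P.nonempty_of_mem_parts (e j).2, rfl, Fintype.mem_piFinset.1 hw _⟩

lemma toFinset_blockWord_blocks (e : Fin k ≃ P.parts) (hw : w ∈ interiors P) (j : Fin k) :
    (blockWord (blocks e w j)).toFinset = e j :=
  (mem_stirlingOn.1 (blockWord_blocks_mem_stirlingOn e hw j)).1

lemma separated_blocks (e : Fin k ≃ P.parts) (hw : w ∈ interiors P) :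
    Separated (List.ofFn (blocks e w)) := by
  refine ⟨List.forall_mem_ofFn_iff.2 fun j hj => ?_, List.pairwise_ofFn.2 fun i j hij => ?_⟩
  · have hperm := (mem_stirlingOn.1 (blockWord_blocks_mem_stirlingOn e hw j)).2
    exact ((isStirlingPerm_blockWord.1 hperm).2 _ hj).false
  · rw [← List.disjoint_toFinset_iff_disjoint, toFinset_blockWord_blocks e hw,
      toFinset_blockWord_blocks e hw]
    exact P.disjoint (e i).2 (e j).2 fun h => hij.ne (e.injective (Subtype.ext h))

lemma assemble_blocks_mem_stirlingOn (e : Fin k ≃ P.parts) (hw : w ∈ interiors P) :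
    assemble (List.ofFn (blocks e w)) ∈ stirlingOn S := by
  refine mem_stirlingOn.2 ⟨?_, (separated_blocks e hw).isStirlingPerm_assemble.2 <|
    List.forall_mem_ofFn_iff.2 fun j =>
      (mem_stirlingOn.1 (blockWord_blocks_mem_stirlingOn e hw j)).2⟩
  have hmem : ∀ i j, i ∈ blockWord (blocks e w j) ↔ i ∈ (e j).1 := fun i j => by
    rw [← List.mem_toFinset, toFinset_blockWord_blocks e hw]
  ext i
  simp only [List.mem_toFinset, mem_assemble_ofFn, hmem]
  refine (e.surjective.exists (p := fun U : P.parts => i ∈ U.1)).symm.trans ?_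
  exact ⟨fun ⟨U, hi⟩ => P.le U.2 hi, fun hi => ⟨⟨_, P.part_mem.2 hi⟩, P.mem_part_self.2 hi⟩⟩

lemma exists_blocks_eq {B : Fin k → ℕ × List ℕ} (h : Separated (List.ofFn B))
    (hS : assemble (List.ofFn B) ∈ stirlingOn S) :
    ∃ (P : Finpartition S) (e : Fin k ≃ P.parts), ∃ w ∈ interiors P, blocks e w = B := by
  obtain ⟨hletters, hperm⟩ := mem_stirlingOn.1 hS
  rw [h.isStirlingPerm_assemble, List.forall_mem_ofFn_iff] at hperm
  let V : Fin k → Finset ℕ := fun j => (blockWord (B j)).toFinset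
  have hne : ∀ j, (V j).Nonempty := fun j => ⟨(B j).1, List.mem_toFinset.2 (head_mem_blockWord _)⟩
  have hunion : ∀ i, i ∈ S ↔ ∃ j, i ∈ V j := fun i => by
    simp only [V, ← hletters, List.mem_toFinset, mem_assemble_ofFn]
  have hunique : ∀ {i j m}, i ∈ V j → i ∈ V m → j = m := fun {i j m} hj hm =>
    List.nodup_ofFn.1 h.nodup <| h.eq_of_mem (List.mem_ofFn.2 ⟨j, rfl⟩) (List.mem_ofFn.2 ⟨m, rfl⟩)
      (List.mem_toFinset.1 hj) (List.mem_toFinset.1 hm)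
  obtain ⟨P, e, he⟩ := exists_finpartition_equiv hne (fun j i hi => (hunion i).2 ⟨j, hi⟩)
    fun i hi => existsUnique_of_exists_of_unique ((hunion i).1 hi) fun _ _ => hunique
  have hblock : ∀ j, (e j).1.Nonempty ∧ (B j).1 = leader (e j) ∧
      (B j).2 ∈ stirlingOn ((e j).1.erase (leader (e j))) := fun j =>
    blockWord_mem_stirlingOn.1 (mem_stirlingOn.2 ⟨(he j).symm, hperm j⟩)
  refine ⟨P, e, fun U => (B (e.symm U)).2, Fintype.mem_piFinset.2 ?_, funext fun j => ?_⟩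
  · refine e.forall_congr_right.1 fun j => ?_
    rw [e.symm_apply_apply]
    exact (hblock j).2.2
  · rw [blocks, e.symm_apply_apply]
    exact Prod.ext (hblock j).2.1.symm rfl

lemma parts_eq_image_blocks (e : Fin k ≃ P.parts) (hw : w ∈ interiors P) :
    P.parts = ((List.ofFn (blocks e w)).map fun B => (blockWord B).toFinset).toFinset := by
  ext U
  simp only [List.map_ofFn, List.mem_toFinset, List.mem_ofFn, Function.comp_apply,
    toFinset_blockWord_blocks e hw]
  exact ⟨fun hU => ⟨e.symm ⟨U, hU⟩, by rw [e.apply_symm_apply]⟩, fun ⟨j, hj⟩ => hj ▸ (e j).2⟩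

lemma blocks_injective {e e' : Fin k ≃ P.parts} {w w' : P.parts → List ℕ}
    (h : blocks e w = blocks e' w') : e = e' ∧ w = w' := by
  have he : e = e' := Equiv.ext fun j => injective_leader_parts P (congrArg Prod.fst (congrFun h j))
  refine ⟨he, funext <| e.surjective.forall.2 fun j => ?_⟩
  subst he
  exact congrArg Prod.snd (congrFun h j)

theorem sum_stirlingOn_eq_sum_finpartition {M : Type*} [AddCommMonoid M] (S : Finset ℕ)
    (Φ : List ℕ → M) :
    ∑ σ ∈ stirlingOn S, Φ σ =
      ∑ P : Finpartition S, ∑ e : Fin P.parts.card ≃ P.parts, ∑ w ∈ interiors P,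
        Φ (assemble (List.ofFn (blocks e w))) := by
  simp only [← Finset.sum_product', Finset.sum_sigma']
  symm
  refine Finset.sum_bij (fun t _ => assemble (List.ofFn (blocks t.2.1 t.2.2))) ?_ ?_ ?_ ?_
  · simp only [Finset.mem_sigma, Finset.mem_product, Finset.mem_univ, true_and]
    exact fun t hw => assemble_blocks_mem_stirlingOn t.2.1 hw
  · rintro ⟨P, e, w⟩ hw ⟨P', e', w'⟩ hw' h
    simp only [Finset.mem_sigma, Finset.mem_product, Finset.mem_univ, true_and] at hw hw'
    have hlist := (separated_blocks e hw).eq_of_assemble_eq (separated_blocks e' hw') h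
    obtain rfl : P = P' := Finpartition.ext <| by
      rw [parts_eq_image_blocks e hw, parts_eq_image_blocks e' hw', hlist]
    obtain ⟨rfl, rfl⟩ := blocks_injective (List.ofFn_injective hlist)
    rfl
  · intro σ hσ
    obtain ⟨L, hL, rfl⟩ := (mem_stirlingOn.1 hσ).2.exists_assemble_eq
    obtain ⟨k, B, rfl⟩ : ∃ k, ∃ B : Fin k → ℕ × List ℕ, List.ofFn B = L :=
      ⟨L.length, L.get, List.ofFn_get L⟩
    obtain ⟨P, e, w, hw, rfl⟩ := exists_blocks_eq hL hσ
    obtain rfl : k = P.parts.card := by simpa using Fintype.card_congr e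
    exact ⟨⟨P, e, w⟩, by simpa using hw, rfl⟩
  · exact fun _ _ => rfl

end Blocks

/-! ### Summation over set partitions -/

lemma sum_orderWeight_leader {R : Type*} [CommRing R] (A : Set PermPattern) (p : PermPattern)
    (z : R) {S : Finset ℕ} (P : Finpartition S) :
    ∑ e : Fin P.parts.card ≃ P.parts, orderWeight A p z (fun m => leader (e m)) =
      fCoeff A p P.parts.card z :=
  sum_orderWeight_equiv A p z (b := fun U : P.parts => leader U)
    (Fintype.card_coe P.parts) (injective_leader_parts P)

section Summation
variable {R : Type*} [CommRing R] (A : ℕ → Set PermPattern) (p : ℕ → PermPattern) (x y : ℕ → R)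

lemma sum_interiors_prod_wordWeight {S : Finset ℕ} (P : Finpartition S) (h0 : 0 ∉ S) :
    ∑ w ∈ interiors P, ∏ U : P.parts, wordWeight A p x y (w U) =
      ∏ U ∈ P.parts, gCoeff A p (U.card - 1) x y := by
  rw [interiors, ← Finset.prod_univ_sum,
    ← Finset.prod_coe_sort P.parts fun U => gCoeff A p (U.card - 1) x y]
  refine Fintype.prod_congr _ _ fun U => ?_
  rw [sum_wordWeight_stirlingOn _ _ _ _ fun h => h0 (P.le U.2 (Finset.mem_of_mem_erase h)),
    Finset.card_erase_of_mem (leader_mem (P.nonempty_of_mem_parts U.2))]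

theorem gCoeff_eq_sum_finpartition (n : ℕ) :
    gCoeff A p n x y = ∑ P : Finpartition (Finset.Icc 1 n),
      y 0 ^ P.parts.card * fCoeff (A 0) (p 0) P.parts.card (x 0) *
        ∏ U ∈ P.parts, gCoeff (shift A) (shift p) (U.card - 1) (shift x) (shift y) := by
  rw [gCoeff_eq_sum_wordWeight, sum_stirlingOn_eq_sum_finpartition]
  refine Fintype.sum_congr _ _ fun P => ?_
  have hweight : ∀ (e : Fin P.parts.card ≃ P.parts), ∀ w ∈ interiors P,
      wordWeight A p x y (assemble (List.ofFn (blocks e w))) =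
        orderWeight (A 0) (p 0) (x 0) (fun m => leader (e m)) * y 0 ^ P.parts.card *
          ∏ U : P.parts, wordWeight (shift A) (shift p) (shift x) (shift y) (w U) :=
    fun e w hw => by
      rw [wordWeight_assemble_ofFn A p x y (separated_blocks e hw)]
      exact congrArg _ (e.prod_comp fun U =>
        wordWeight (shift A) (shift p) (shift x) (shift y) (w U))
  rw [Fintype.sum_congr _ _ fun e => Finset.sum_congr rfl (hweight e)]
  simp only [← Finset.mul_sum, ← Finset.sum_mul]
  rw [sum_interiors_prod_wordWeight _ _ _ _ P (by simp), sum_orderWeight_leader,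
    mul_comm (fCoeff _ _ _ _)]

end Summation

end BlockPattern

open BlockPattern in
theorem corollary2_general {R : Type*} [CommRing R] (A : ℕ → Set PermPattern)
    (p : ℕ → PermPattern) (x y : ℕ → R) (n : ℕ) :
    gCoeff A p n x y =
      ∑ lam : n.Partition, lam.parts.bell •
        (y 0 ^ lam.parts.card * fCoeff (A 0) (p 0) lam.parts.card (x 0) *
          (lam.parts.map fun k =>
            gCoeff (shift A) (shift p) (k - 1) (shift x) (shift y)).prod) := by
  rw [gCoeff_eq_sum_finpartition, ← sum_finpartition_eq_sum_partition (fun m : Multiset ℕ =>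
    y 0 ^ m.card * fCoeff (A 0) (p 0) m.card (x 0) *
      (m.map fun k => gCoeff (shift A) (shift p) (k - 1) (shift x) (shift y)).prod)
    (S := Finset.Icc 1 n) (by simp)]
  refine Fintype.sum_congr _ _ fun P => ?_
  rw [Multiset.card_map, Multiset.map_map]
  rfl

theorem corollary2 {R : Type*} [CommRing R] [Algebra ℚ R]
    (A : ℕ → Set BlockPattern.PermPattern) (p : ℕ → BlockPattern.PermPattern)
    (x y : ℕ → R) (n : ℕ) :
    BlockPattern.gCoeff A p n x y =
      ∑ lam : n.Partition,
        (((n.factorial : ℚ) / (lam.parts.map (fun k => (k.factorial : ℚ))).prod) /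
            (∏ i ∈ Finset.Icc 1 n, ((lam.parts.count i).factorial : ℚ))) •
          (y 0 ^ lam.parts.card *
            BlockPattern.fCoeff (A 0) (p 0) lam.parts.card (x 0) *
            (lam.parts.map (fun k =>
              BlockPattern.gCoeff (BlockPattern.shift A) (BlockPattern.shift p) (k - 1)
                (BlockPattern.shift x) (BlockPattern.shift y))).prod) := by
  rw [corollary2_general]
  exact Fintype.sum_congr _ _ fun lam => by
    rw [← BlockPattern.cast_bell, Nat.cast_smul_eq_nsmul]
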